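/- **Proposition 3.3 (a priori estimate for Galerkin solutions).** Let $d\ge 1$, let $\Omega\subset\mathbb R^d$ be a bounded domain with $C^1$ boundary, let $T>0$, $\alpha\in(0,1)$ and $\Omega_T=(0,T]\times\Omega$. Let $a_{ij},b_j,c\in L^\infty(\Omega_T;\mathbb R)$ $(1\le i,j\le d)$ with $a_{ij}=a_{ji}$, and suppose that there is $\theta>0$ with $\sum_{i,j}a_{ij}(t,x)\xi_i\xi_j\ge\theta\|\xi\|^2$ for a.e. $(t,x)\in\Omega_T$ and all $\xi\in\mathbb R^d$. Let $H^1_0(\Omega)$ be the closure of $C_c^\infty(\Omega)$ in $H^1(\Omega)$, with the norm $\|v\|_{H^1_0}^2=\|v\|_{L^2}^2+\|Dv\|_{L^2}^2$, and let $H^{-1}(\Omega)$ be its dual space with the dual norm; $w\in L^2(\Omega)$ is identified with the functional $v\mapsto (w,v)_{L^2}$ in $H^{-1}(\Omega)$. For $u,v\in H^1_0(\Omega)$ put $$a(u,v;t)=\int_\Omega\Big(\sum_{i,j=1}^d a_{ij}(t,x)\,\partial_{x_j}u\,\partial_{x_i}v+\sum_{j=1}^d b_j(t,x)\,\partial_{x_j}u\,v+c(t,x)\,u\,v\Big)dx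 .$$ For a function $x$ on $[0,T]$ let $(I^{1-\alpha}_{0+}x)(t)=\frac1{\Gamma(1-\alpha)}\int_0^t(t-\tau)^{-\alpha}x(\tau)\,d\tau$ and ${}^{RL}D^\alpha_{0+}x=\frac{d}{dt}I^{1-\alpha}_{0+}x$ (a.e. on $[0,T]$). Let $(e_j)_{j\ge1}$ be functions in $H^1_0(\Omega)\cap C^\infty(\Omega)$ that form an orthonormal basis of $L^2(\Omega)$ and a basis of $H^1_0(\Omega)$, with $-\Delta e_j=\lambda_je_j$ in $\Omega$ and $\int_\Omega De_i\cdot De_j\,dx=\lambda_i\delta_{ij}$, and let $E_N=\operatorname{span}\{e_1,\dots,e_N\}$. For $f\in L^\infty([0,T];H^{-1}(\Omega))$, a *Galerkin solution* of level $N$ is a function $\mathbf u_N(t)=\sum_{i=1}^Nc^i(t)e_i$, $t\in[0,T]$, where each $c^i$ is continuous on $[0,T]$ and $I^{1-\alpha}_{0+}c^i$ is absolutely continuous on $[0,T]$, such that $\mathbf u_N(0)=0$ and, for every $v\in E_N$, $$({}^{RL}D^\alpha_{0+}\mathbf u_N(t),v)_{L^2}+a(\mathbf u_N(t),v;t)=\langle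 f(t),v\rangle_{H^{-1}\times H^1_0}\qquad\text{for a.e. }t\in(0,T).$$ Then there is a constant $C>0$, depending only on $\Omega$, $T$ and the equation (that is, on $\alpha$ and the coefficients $a_{ij},b_j,c$), and in particular not on $N$, $f$ or the basis $(e_j)$, such that for every such basis, every $f\in L^\infty([0,T];H^{-1}(\Omega))$, every $N$ and every Galerkin solution $\mathbf u_N$ of level $N$: the functions $\mathbf u_N$ and ${}^{RL}D^\alpha_{0+}\mathbf u_N$ belong to $L^2([0,T];H^1_0(\Omega))$ (hence to $L^2([0,T];L^2(\Omega))$) and to $L^2([0,T];H^{-1}(\Omega))$ respectively, and $$\|\mathbf u_N\|^2_{L^2([0,T];L^2(\Omega))}+\|\mathbf u_N\|^2_{L^2([0,T];H^1_0(\Omega))}+\|{}^{RL}D^\alpha_{0+}\mathbf u_N\|^2_{L^2([0,T];H^{-1}(\Omega))}\le C\,\|f\|^2_{L^\infty([0,T];H^{-1}(\Omega))}.$$ -/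

import Mathlib

open MeasureTheory Set
open scoped ContDiff ENNReal

noncomputable section

namespace FracElliptic

/-- Euclidean space `ℝ^d`. -/
abbrev Euc (d : ℕ) : Type := EuclideanSpace ℝ (Fin d)

/-- The domain `Ω` has a `C¹` boundary: near each boundary point, after a choice of orthonormal
axes with last axis `ν`, `Ω` is the strict epigraph of a `C¹` function of the coordinates
orthogonal to `ν` (the coordinates of `x` orthogonal to `ν` are the vector `x - ⟪ν, x⟫ ν`). -/
def HasC1Boundary {d : ℕ} (Ω : Set (Euc d)) : Prop :=
  ∀ x₀ ∈ frontier Ω, ∃ r > 0, ∃ ν : Euc d, ‖ν‖ = 1 ∧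
    ∃ γ : Euc d → ℝ, ContDiff ℝ 1 γ ∧
      ∀ x ∈ Metric.ball x₀ r, x ∈ Ω ↔ γ (x - inner ℝ ν x • ν) < inner ℝ ν x

/-- A bounded domain (bounded, open, connected, non-empty) with `C¹` boundary. -/
structure IsBoundedC1Domain {d : ℕ} (Ω : Set (Euc d)) : Prop where
  isOpen : IsOpen Ω
  isConnected : IsConnected Ω
  isBounded : Bornology.IsBounded Ω
  boundary : HasC1Boundary Ω

/-! ### Sobolev spaces -/

/-- The elements of `C_c^∞(Ω)`. -/
structure IsTestFunction {d : ℕ} (Ω : Set (Euc d)) (φ : Euc d → ℝ) : Prop where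
  contDiff : ContDiff ℝ ∞ φ
  hasCompactSupport : HasCompactSupport φ
  tsupport_subset : tsupport φ ⊆ Ω

/-- `L²(Ω)`. -/
abbrev L2 {d : ℕ} (Ω : Set (Euc d)) : Type :=
  Lp ℝ 2 ((volume : Measure (Euc d)).restrict Ω)

/-- `L²(Ω) × L²(Ω; ℝ^d)` with the Hilbert norm `(‖u‖² + ‖g‖²)^{1/2}`. A Sobolev function `u` is
represented in it by the pair `(u, Du)`, so that this norm is the norm of `H¹(Ω)`. -/
abbrev L2Pair {d : ℕ} (Ω : Set (Euc d)) : Type :=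
  WithLp 2 (L2 Ω × Lp (Euc d) 2 ((volume : Measure (Euc d)).restrict Ω))

/-- `g` is the weak gradient of `u` on `Ω`. -/
def IsWeakGradient {d : ℕ} (Ω : Set (Euc d)) (u : Euc d → ℝ) (g : Euc d → Euc d) : Prop :=
  ∀ φ : Euc d → ℝ, IsTestFunction Ω φ → ∀ i : Fin d,
    ∫ x in Ω, u x * fderiv ℝ φ x (EuclideanSpace.single i 1) = - ∫ x in Ω, g x i * φ x

/-- `H¹(Ω)`: the pairs `(u, Du)` with `u ∈ L²(Ω)` and weak gradient `Du ∈ L²(Ω; ℝ^d)`. -/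
def H1 {d : ℕ} (Ω : Set (Euc d)) : Set (L2Pair Ω) :=
  {p | IsWeakGradient Ω p.fst p.snd}

/-- `H¹₀(Ω)`: the closure of `C_c^∞(Ω)`, that is, of the pairs `(φ, Dφ)` with `φ ∈ C_c^∞(Ω)`, in
the norm of `H¹(Ω)`. (These pairs already form a linear subspace. Their closure in
`L²(Ω) × L²(Ω; ℝ^d)` lies in `H¹(Ω)`, see `H10_subset_H1`, so it is the closure in `H¹(Ω)`.) -/
def H10 {d : ℕ} (Ω : Set (Euc d)) : Submodule ℝ (L2Pair Ω) :=
  (Submodule.span ℝ {p : L2Pair Ω | ∃ φ : Euc d → ℝ, IsTestFunction Ω φ ∧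
    p.fst =ᵐ[volume.restrict Ω] φ ∧ p.snd =ᵐ[volume.restrict Ω] gradient φ}).topologicalClosure

/-- `H⁻¹(Ω)`: the dual space of `H¹₀(Ω)` with the operator norm. -/
abbrev Hm1 {d : ℕ} (Ω : Set (Euc d)) : Type := StrongDual ℝ (H10 Ω)

/-- The inclusion `H¹₀(Ω) ⊆ L²(Ω)`. -/
def toL2 {d : ℕ} (Ω : Set (Euc d)) : H10 Ω →L[ℝ] L2 Ω :=
  (WithLp.fstL 2 ℝ (L2 Ω) (Lp (Euc d) 2 ((volume : Measure (Euc d)).restrict Ω))).comp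
    (H10 Ω).subtypeL

/-- The weak gradient `H¹₀(Ω) → L²(Ω; ℝ^d)`. -/
def grad {d : ℕ} (Ω : Set (Euc d)) :
    H10 Ω →L[ℝ] Lp (Euc d) 2 ((volume : Measure (Euc d)).restrict Ω) :=
  (WithLp.sndL 2 ℝ (L2 Ω) (Lp (Euc d) 2 ((volume : Measure (Euc d)).restrict Ω))).comp
    (H10 Ω).subtypeL

/-- The embedding `H¹₀(Ω) ⊆ L²(Ω) ⊆ H⁻¹(Ω)`, `w ↦ (v ↦ (w, v)_{L²})`. -/
def toHm1 {d : ℕ} (Ω : Set (Euc d)) (w : H10 Ω) : Hm1 Ω :=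
  (innerSL ℝ (toL2 Ω w)).comp (toL2 Ω)

/-! ### Riemann--Liouville calculus -/

/-- The Riemann--Liouville integral
`(I_{0+}^β x)(t) = Γ(β)⁻¹ ∫_0^t (t-τ)^{β-1} x(τ) dτ` of a vector-valued function. -/
def rlIntegral {X : Type*} [NormedAddCommGroup X] [NormedSpace ℝ X] (β : ℝ) (x : ℝ → X)
    (t : ℝ) : X :=
  (Real.Gamma β)⁻¹ • ∫ τ in (0 : ℝ)..t, (t - τ) ^ (β - 1) • x τ

/-- The Riemann--Liouville derivative `(d/dt) I_{0+}^{1-α} x`. -/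
def rlDeriv {X : Type*} [NormedAddCommGroup X] [NormedSpace ℝ X] (α : ℝ) (x : ℝ → X)
    (t : ℝ) : X :=
  deriv (rlIntegral (1 - α) x) t

/-- The scalar function `x` has a Riemann--Liouville derivative of order `α` on `[0,T]`:
`I_{0+}^{1-α} x` is absolutely continuous on `[0,T]`, hence it is differentiable a.e. and the
primitive of its derivative. -/
def HasRLDeriv (α T : ℝ) (x : ℝ → ℝ) : Prop :=
  AbsolutelyContinuousOnInterval (rlIntegral (1 - α) x) 0 T

/-! ### The equation -/

/-- Lebesgue measure on `Ω_T = (0,T] × Ω`. -/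
def cylMeasure {d : ℕ} (Ω : Set (Euc d)) (T : ℝ) : Measure (ℝ × Euc d) :=
  (volume : Measure (ℝ × Euc d)).restrict (Ioc 0 T ×ˢ Ω)

/-- Assumptions on the coefficients: all of them lie in `L^∞(Ω_T)`, and `(a_ij)` is symmetric and
uniformly elliptic. -/
structure IsAdmissible {d : ℕ} (Ω : Set (Euc d)) (T : ℝ) (a : Fin d → Fin d → ℝ × Euc d → ℝ)
    (b : Fin d → ℝ × Euc d → ℝ) (c : ℝ × Euc d → ℝ) : Prop where
  memLp_a : ∀ i j, MemLp (a i j) ∞ (cylMeasure Ω T)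
  memLp_b : ∀ j, MemLp (b j) ∞ (cylMeasure Ω T)
  memLp_c : MemLp c ∞ (cylMeasure Ω T)
  symm : ∀ i j, a i j =ᵐ[cylMeasure Ω T] a j i
  elliptic : ∃ θ > 0, ∀ᵐ p ∂(cylMeasure Ω T), ∀ ξ : Euc d,
    θ * ‖ξ‖ ^ 2 ≤ ∑ i, ∑ j, a i j p * ξ i * ξ j

/-- The form
`a(u,v;t) = ∫_Ω ∑ a_ij ∂_j u ∂_i v + ∑ b_j ∂_j u v + c u v dx` on `H¹₀(Ω)`. -/
def form {d : ℕ} (Ω : Set (Euc d)) (a : Fin d → Fin d → ℝ × Euc d → ℝ)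
    (b : Fin d → ℝ × Euc d → ℝ) (c : ℝ × Euc d → ℝ) (u v : H10 Ω) (t : ℝ) : ℝ :=
  ∫ x in Ω, ((∑ i, ∑ j, a i j (t, x) * grad Ω u x j * grad Ω v x i)
    + (∑ j, b j (t, x) * grad Ω u x j * toL2 Ω v x) + c (t, x) * toL2 Ω u x * toL2 Ω v x)

/-- `e 0, e 1, …` is a basis of smooth eigenfunctions of the Dirichlet Laplacian on `Ω`, with
eigenvalues `lam 0, lam 1, …`: it is an orthonormal basis of `L²(Ω)` and an orthogonal basis of
`H¹₀(Ω)`. -/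
structure IsDirichletEigenbasis {d : ℕ} (Ω : Set (Euc d)) (e : ℕ → H10 Ω) (lam : ℕ → ℝ) :
    Prop where
  smooth_eigen : ∀ k, ∃ w : Euc d → ℝ, ContDiffOn ℝ ∞ w Ω ∧
    toL2 Ω (e k) =ᵐ[volume.restrict Ω] w ∧ ∀ x ∈ Ω, - Laplacian.laplacian w x = lam k * w x
  orthonormal : Orthonormal ℝ (fun k => toL2 Ω (e k))
  inner_grad : ∀ i j, inner ℝ (grad Ω (e i)) (grad Ω (e j)) = if i = j then lam i else 0
  dense_L2 : (Submodule.span ℝ (range fun k => toL2 Ω (e k))).topologicalClosure = ⊤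
  dense_H10 : (Submodule.span ℝ (range e)).topologicalClosure = ⊤

/-- `E_N`, the span of the first `N` basis functions. -/
def galerkinSpace {d : ℕ} {Ω : Set (Euc d)} (e : ℕ → H10 Ω) (N : ℕ) : Submodule ℝ (H10 Ω) :=
  Submodule.span ℝ (range fun i : Fin N => e i)

/-- `u` is a Galerkin solution of level `N`: on `[0,T]` it has the form `∑_{i<N} κ_i(t) e_i` with
continuous coefficients that have a Riemann--Liouville derivative of order `α`, it satisfies
`(D^α u(t), v)_{L²} + a(u(t), v; t) = ⟨f(t), v⟩` for all `v ∈ E_N` and a.e. `t ∈ (0,T)`, and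
`u(0) = 0`. -/
structure IsGalerkinSolution {d : ℕ} (Ω : Set (Euc d)) (T α : ℝ)
    (a : Fin d → Fin d → ℝ × Euc d → ℝ) (b : Fin d → ℝ × Euc d → ℝ) (c : ℝ × Euc d → ℝ)
    (f : ℝ → Hm1 Ω) (e : ℕ → H10 Ω) (N : ℕ) (u : ℝ → H10 Ω) : Prop where
  expansion : ∃ κ : Fin N → ℝ → ℝ, (∀ i, ContinuousOn (κ i) (Icc 0 T)) ∧
    (∀ i, HasRLDeriv α T (κ i)) ∧ ∀ t ∈ Icc 0 T, u t = ∑ i : Fin N, κ i t • e i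
  equation : ∀ v ∈ galerkinSpace e N, ∀ᵐ t ∂(volume.restrict (Ioo 0 T)),
    inner ℝ (toL2 Ω (rlDeriv α u t)) (toL2 Ω v) + form Ω a b c (u t) v t = f t v
  initial : u 0 = 0

/-! ### Elements of `H¹₀(Ω)` have weak gradients -/

theorem IsTestFunction.memLp {d : ℕ} {Ω : Set (Euc d)} {φ : Euc d → ℝ}
    (h : IsTestFunction Ω φ) : MemLp φ 2 (volume.restrict Ω) :=
  (h.contDiff.continuous.memLp_of_hasCompactSupport h.hasCompactSupport).restrict _

theorem IsTestFunction.memLp_fderiv {d : ℕ} {Ω : Set (Euc d)} {φ : Euc d → ℝ}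
    (h : IsTestFunction Ω φ) (y : Euc d) :
    MemLp (fun x => fderiv ℝ φ x y) 2 (volume.restrict Ω) := by
  refine (Continuous.memLp_of_hasCompactSupport ?_ ?_).restrict _
  · exact (h.contDiff.continuous_fderiv (by simp)).clm_apply continuous_const
  · exact h.hasCompactSupport.fderiv_apply (𝕜 := ℝ) y

/-- `H¹(Ω)` as an intersection of closed hyperplanes of `L²(Ω) × L²(Ω; ℝ^d)`. -/
theorem mem_H1_iff {d : ℕ} {Ω : Set (Euc d)} (p : L2Pair Ω) :
    p ∈ H1 Ω ↔ ∀ (φ : Euc d → ℝ) (h : IsTestFunction Ω φ) (i : Fin d),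
      inner ℝ ((h.memLp_fderiv (EuclideanSpace.single i 1)).toLp _) p.fst
        + inner ℝ ((h.memLp.toLp _)) ((EuclideanSpace.proj (𝕜 := ℝ) i).compLp p.snd) = 0 := by
  unfold H1 IsWeakGradient
  simp only [mem_ofPred_eq]
  refine forall_congr' fun φ => forall_congr' fun h => forall_congr' fun i => ?_
  rw [L2.inner_def, L2.inner_def, eq_neg_iff_add_eq_zero]
  have h1 := (h.memLp_fderiv (EuclideanSpace.single i 1)).coeFn_toLp
  have h2 := h.memLp.coeFn_toLp
  have h3 := (EuclideanSpace.proj (𝕜 := ℝ) i).coeFn_compLp p.snd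
  have e1 : ∫ x in Ω, p.fst x * fderiv ℝ φ x (EuclideanSpace.single i 1)
      = ∫ x in Ω, inner ℝ ((h.memLp_fderiv (EuclideanSpace.single i 1)).toLp _ x) (p.fst x) := by
    refine integral_congr_ae ?_
    filter_upwards [h1] with x hx
    rw [hx]; simp
  have e2 : ∫ x in Ω, p.snd x i * φ x
      = ∫ x in Ω, inner ℝ (h.memLp.toLp _ x)
          ((EuclideanSpace.proj (𝕜 := ℝ) i).compLp p.snd x) := by
    refine integral_congr_ae ?_
    filter_upwards [h2, h3] with x hx hx'
    rw [hx, hx']; simp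
  rw [e1, e2]

/-- Every element of `H¹₀(Ω)` is a pair `(u, Du)` in `H¹(Ω)`. -/
theorem H10_subset_H1 {d : ℕ} (Ω : Set (Euc d)) : (H10 Ω : Set (L2Pair Ω)) ⊆ H1 Ω := by
  intro p hp
  rw [mem_H1_iff]
  intro φ h i
  set L : L2Pair Ω →L[ℝ] ℝ :=
    (innerSL ℝ ((h.memLp_fderiv (EuclideanSpace.single i 1)).toLp _)).comp (WithLp.fstL 2 ℝ _ _)
      + (innerSL ℝ (h.memLp.toLp _)).comp
        (((EuclideanSpace.proj (𝕜 := ℝ) i).compLpL 2 (volume.restrict Ω)).comp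
          (WithLp.sndL 2 ℝ _ _)) with hL
  have hker : H10 Ω ≤ LinearMap.ker L.toLinearMap := by
    refine Submodule.topologicalClosure_minimal _ (Submodule.span_le.2 ?_) L.isClosed_ker
    rintro q ⟨ψ, hψ, hq1, hq2⟩
    change L q = 0
    refine (mem_H1_iff q).1 ?_ φ h i
    intro χ hχ j
    have e1 : ∫ x in Ω, q.fst x * fderiv ℝ χ x (EuclideanSpace.single j 1)
        = ∫ x in Ω, ψ x * fderiv ℝ χ x (EuclideanSpace.single j 1) := by
      refine integral_congr_ae ?_
      filter_upwards [hq1] with x hx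
      rw [hx]
    have e2 : ∫ x in Ω, q.snd x j * χ x
        = ∫ x in Ω, fderiv ℝ ψ x (EuclideanSpace.single j 1) * χ x := by
      refine integral_congr_ae ?_
      filter_upwards [hq2] with x hx
      have hg := EuclideanSpace.inner_single_right (𝕜 := ℝ) j 1 (gradient ψ x)
      have hd : inner ℝ (gradient ψ x) (EuclideanSpace.single j 1)
          = fderiv ℝ ψ x (EuclideanSpace.single j 1) := by
        simp [gradient]
      rw [hx, ← hd, hg]; simp
    have s1 : ∀ x, x ∉ Ω → ψ x = 0 := fun x hx =>
      image_eq_zero_of_notMem_tsupport fun hx' => hx (hψ.tsupport_subset hx')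
    have s2 : ∀ x, x ∉ Ω → χ x = 0 := fun x hx =>
      image_eq_zero_of_notMem_tsupport fun hx' => hx (hχ.tsupport_subset hx')
    rw [e1, e2, setIntegral_eq_integral_of_forall_compl_eq_zero fun x hx => by rw [s1 x hx, zero_mul],
      setIntegral_eq_integral_of_forall_compl_eq_zero fun x hx => by rw [s2 x hx, mul_zero]]
    have dψ : Continuous fun x => fderiv ℝ ψ x (EuclideanSpace.single j 1) :=
      (hψ.contDiff.continuous_fderiv (by simp)).clm_apply continuous_const
    have dχ : Continuous fun x => fderiv ℝ χ x (EuclideanSpace.single j 1) :=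
      (hχ.contDiff.continuous_fderiv (by simp)).clm_apply continuous_const
    have cψ := hψ.contDiff.continuous
    have cχ := hχ.contDiff.continuous
    refine integral_mul_fderiv_eq_neg_fderiv_mul_of_integrable ?_ ?_ ?_
      (fun x _ => hψ.contDiff.differentiable (by simp) x)
      (fun x _ => hχ.contDiff.differentiable (by simp) x)
    · exact (dψ.mul cχ).integrable_of_hasCompactSupport hχ.hasCompactSupport.mul_left
    · exact (cψ.mul dχ).integrable_of_hasCompactSupport hψ.hasCompactSupport.mul_right
    · exact (cψ.mul cχ).integrable_of_hasCompactSupport hψ.hasCompactSupport.mul_right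
  exact hker hp

end FracElliptic

end

open FracElliptic

/-!
The estimate is an energy estimate with the weight `exp (-2γt)`, `γ` large.

Testing the equation with `u_N(t)` gives `(D^α u_N, u_N) + a(u_N, u_N; t) = ⟨f, u_N⟩`, and for almost
every `t` the form satisfies `m ‖u‖²_{H¹₀} - K ‖u‖²_{L²} ≤ a(u, u; t)` (`IsRegularTime.le_form_self`).
The negative term is absorbed because the weight makes the fractional derivative as coercive as one
likes: for every `K` there is a `γ` with
`K ∫ exp (-2γt) x² ≤ ∫ exp (-2γt) x D^α x` on `(0, T)` for all `x` with bounded `D^α x`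
(`exists_weight_rlDeriv_coercive`). Boundedness of the derivatives of the Galerkin coefficients is
read off from the equation, and the constant does not see the bound.

The coercivity rests on two facts. First, `x = I^α D^α x` almost everywhere
(`ae_eq_abelIntegral_rlDeriv`): convolve `x * t^{-α} = Γ(1-α) (D^α x * 1)` with `t^{α-1}`, use that
`t^{-α} * t^{α-1}` is constant, and differentiate. Second, for `h = D^α x` the kernel identity
`Γ(1-α) r^{α-1} = ∫_0^∞ λ^{-α} exp (-λr) dλ` writes `I^α h` as a positive superposition of the
solutions of `w' = h - λ w`, `w(0) = 0` (`relax`). For each of them an integration by parts gives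
`∫ exp (-2γs) w h ≥ (γ + λ) ∫ exp (-2γs) w²`, and these inequalities are summed over `λ` with the
elementary bound `(γ + λ) w² ≥ 2 p w - p² / (γ + λ)`, where `∫_0^∞ λ^{-α} / (γ + λ) dλ` is small for
large `γ` (`exists_weight_abelIntegral_coercive`).

For the derivative in `H⁻¹(Ω)`, the `L²`-projection onto `E_N` is also the `H¹₀`-orthogonal
projection, since the `e_j` are eigenfunctions; hence it does not increase the norm of `H¹₀(Ω)`
(`IsDirichletEigenbasis.norm_galerkinProj_le`), and the equation, which only tests with `E_N`,
controls `‖D^α u_N(t)‖_{H⁻¹}` by `‖f(t)‖ + M ‖u_N(t)‖_{H¹₀}` independently of `N`.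
-/

namespace FracElliptic

/-! ### Abel kernels as superpositions of exponentials -/

/-- Integrate `(exp (-ρ s) W²)' = 2 exp (-ρ s) W H - ρ exp (-ρ s) W²` for the primitive `W` of `H`; the
boundary term at `T` is nonnegative. -/
theorem integral_exp_mul_primitive_mul_ge {T : ℝ} (ρ : ℝ) {H : ℝ → ℝ}
    (hH : IntervalIntegrable H volume 0 T) :
    ρ / 2 * ∫ s in (0 : ℝ)..T, Real.exp (-ρ * s) * (∫ r in (0 : ℝ)..s, H r) ^ 2
      ≤ ∫ s in (0 : ℝ)..T, Real.exp (-ρ * s) * ((∫ r in (0 : ℝ)..s, H r) * H s) := by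
  set W : ℝ → ℝ := fun s => ∫ r in (0 : ℝ)..s, H r with hW
  have acW : AbsolutelyContinuousOnInterval W 0 T :=
    hH.absolutelyContinuousOnInterval_intervalIntegral (by simp)
  have acE : AbsolutelyContinuousOnInterval (fun s => Real.exp (-ρ * s)) 0 T :=
    ContDiffOn.absolutelyContinuousOnInterval (by fun_prop)
  have acF := acE.fun_mul (acW.fun_mul acW)
  have cW : ContinuousOn W (uIcc 0 T) := acW.continuousOn
  have cE : ContinuousOn (fun s : ℝ => Real.exp (-ρ * s)) (uIcc 0 T) := by fun_prop
  have i1 : IntervalIntegrable (fun s => Real.exp (-ρ * s) * W s ^ 2) volume 0 T :=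
    (cE.mul (cW.pow 2)).intervalIntegrable
  have i2 : IntervalIntegrable (fun s => Real.exp (-ρ * s) * (W s * H s)) volume 0 T :=
    (hH.continuousOn_mul cW).continuousOn_mul cE
  have key := acF.integral_deriv_eq_sub
  have hd : ∫ s in (0 : ℝ)..T, deriv (fun s => Real.exp (-ρ * s) * (W s * W s)) s
      = ∫ s in (0 : ℝ)..T, (2 * (Real.exp (-ρ * s) * (W s * H s))
          - ρ * (Real.exp (-ρ * s) * W s ^ 2)) := by
    refine intervalIntegral.integral_congr_ae ?_
    filter_upwards [hH.ae_hasDerivAt_integral] with x hx hx'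
    have h1 : HasDerivAt W (H x) x := hx (uIoc_subset_uIcc hx') 0 (by simp)
    have h2 : HasDerivAt (fun s : ℝ => Real.exp (-ρ * s)) (Real.exp (-ρ * x) * (-ρ * 1)) x :=
      ((hasDerivAt_id x).const_mul (-ρ)).exp
    rw [(h2.fun_mul (h1.fun_mul h1)).deriv]
    ring
  rw [hd, intervalIntegral.integral_sub (i2.const_mul 2) (i1.const_mul ρ),
    intervalIntegral.integral_const_mul, intervalIntegral.integral_const_mul] at key
  have h0 : W 0 = 0 := by simp [hW]
  have hp : 0 ≤ Real.exp (-ρ * T) * (W T * W T) :=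
    mul_nonneg (Real.exp_pos _).le (mul_self_nonneg _)
  rw [h0] at key
  linarith

/-- The solution `w` of `w' = h - l w`, `w(0) = 0`, by Duhamel's formula. -/
noncomputable def relax (h : ℝ → ℝ) (l s : ℝ) : ℝ :=
  ∫ r in (0 : ℝ)..s, Real.exp (-l * (s - r)) * h r

/-- The Abel integral `∫_0^s (s-r)^{β-1} h(r) dr`: the Riemann--Liouville integral of order `β`
without the factor `Γ(β)⁻¹`. -/
noncomputable def abelIntegral (β : ℝ) (h : ℝ → ℝ) (s : ℝ) : ℝ :=
  ∫ r in (0 : ℝ)..s, (s - r) ^ (β - 1) * h r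

theorem intervalIntegrable_of_bounded {h : ℝ → ℝ} (hm : Measurable h) {M : ℝ}
    (hM : ∀ s, |h s| ≤ M) (a b : ℝ) : IntervalIntegrable h volume a b :=
  (intervalIntegrable_const (c := M)).mono_fun hm.aestronglyMeasurable
    (Filter.Eventually.of_forall fun s => by
      simpa only [Real.norm_eq_abs] using (hM s).trans (le_abs_self M))

theorem relax_eq (h : ℝ → ℝ) (l s : ℝ) :
    relax h l s = Real.exp (-l * s) * ∫ r in (0 : ℝ)..s, Real.exp (l * r) * h r := by
  rw [relax, ← intervalIntegral.integral_const_mul]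
  congr 1 with r
  rw [← mul_assoc, ← Real.exp_add]
  ring_nf

theorem integral_exp_mul_relax_mul_ge (T : ℝ) {h : ℝ → ℝ} (hm : Measurable h)
    {M : ℝ} (hM : ∀ s, |h s| ≤ M) (g l : ℝ) :
    (g + l) * ∫ s in (0 : ℝ)..T, Real.exp (-(2 * g) * s) * relax h l s ^ 2
      ≤ ∫ s in (0 : ℝ)..T, Real.exp (-(2 * g) * s) * (relax h l s * h s) := by
  have hI : IntervalIntegrable (fun r => Real.exp (l * r) * h r) volume 0 T :=
    (intervalIntegrable_of_bounded hm hM 0 T).continuousOn_mul (by fun_prop)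
  have := integral_exp_mul_primitive_mul_ge (2 * (g + l)) hI
  rw [show 2 * (g + l) / 2 = g + l by ring] at this
  have e1 : ∀ s, Real.exp (-(2 * g) * s) * relax h l s ^ 2 = Real.exp (-(2 * (g + l)) * s)
      * (∫ r in (0 : ℝ)..s, Real.exp (l * r) * h r) ^ 2 := fun s => by
    rw [relax_eq, mul_pow, ← mul_assoc, ← Real.exp_nat_mul, ← Real.exp_add]
    push_cast
    ring_nf
  have e2 : ∀ s, Real.exp (-(2 * g) * s) * (relax h l s * h s) = Real.exp (-(2 * (g + l)) * s)
      * ((∫ r in (0 : ℝ)..s, Real.exp (l * r) * h r) * (Real.exp (l * s) * h s)) := fun s => by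
    rw [relax_eq]
    set W := ∫ r in (0 : ℝ)..s, Real.exp (l * r) * h r
    have : Real.exp (-(2 * g) * s) * Real.exp (-l * s)
        = Real.exp (-(2 * (g + l)) * s) * Real.exp (l * s) := by
      rw [← Real.exp_add, ← Real.exp_add]; ring_nf
    linear_combination (W * h s) * this
  simp only [e1, e2]
  exact this

/-- Combines the bounds `M s` and `M / l`; it is integrable in `l` against `l ^ (-α)`. -/
theorem abs_relax_le {h : ℝ → ℝ} {M : ℝ} (hM : ∀ s, |h s| ≤ M) {l : ℝ} (hl : 0 ≤ l) {T s : ℝ}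
    (hs : s ∈ Icc 0 T) : |relax h l s| ≤ M * (T + 1) / (1 + l) := by
  have hM0 : 0 ≤ M := (abs_nonneg _).trans (hM 0)
  have hexp : ∫ r in (0 : ℝ)..s, l * Real.exp (-l * (s - r)) = 1 - Real.exp (-l * s) := by
    have := intervalIntegral.integral_eq_sub_of_hasDerivAt
      (f := fun r => Real.exp (-l * (s - r))) (f' := fun r => l * Real.exp (-l * (s - r)))
      (a := 0) (b := s) (fun r _ => by
        have := (((hasDerivAt_id r).const_sub s).const_mul (-l)).exp
        simpa [mul_comm] using this) (Continuous.intervalIntegrable (by fun_prop) _ _)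
    rw [this]; simp
  have h1 : |relax h l s| ≤ M * s := by
    have := intervalIntegral.norm_integral_le_of_norm_le_const (a := 0) (b := s) (C := M)
      (f := fun r => Real.exp (-l * (s - r)) * h r) (fun r hr => by
        rw [uIoc_of_le hs.1] at hr
        rw [norm_mul, Real.norm_eq_abs, Real.norm_eq_abs, Real.abs_exp]
        have : Real.exp (-l * (s - r)) ≤ 1 := by
          rw [Real.exp_le_one_iff]; nlinarith [hr.2]
        exact (mul_le_mul this (hM r) (abs_nonneg _) zero_le_one).trans (by simp))
    simpa [relax, abs_of_nonneg hs.1] using this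
  have h2 : |l * relax h l s| ≤ M := by
    rw [relax, ← intervalIntegral.integral_const_mul]
    have := intervalIntegral.norm_integral_le_of_norm_le (a := 0) (b := s) hs.1
      (f := fun r => l * (Real.exp (-l * (s - r)) * h r))
      (g := fun r => M * (l * Real.exp (-l * (s - r)))) (μ := volume)
      (Filter.Eventually.of_forall fun r _ => by
        rw [Real.norm_eq_abs, abs_mul, abs_mul, Real.abs_exp, abs_of_nonneg hl]
        have := hM r
        have h3 : 0 ≤ l * Real.exp (-l * (s - r)) := by positivity
        nlinarith) (Continuous.intervalIntegrable (by fun_prop) _ _)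
    rw [intervalIntegral.integral_const_mul M, hexp] at this
    refine this.trans ?_
    have := Real.exp_pos (-l * s)
    nlinarith
  rw [abs_mul, abs_of_nonneg hl] at h2
  rw [le_div_iff₀ (by positivity)]
  nlinarith [hs.2, hs.1]

/-- Joint measurability; the maximum avoids the orientation of the integral for negative times. -/
theorem measurable_relax {h : ℝ → ℝ} (hm : Measurable h) :
    Measurable fun p : ℝ × ℝ => relax h p.1 (max p.2 0) := by
  have : (fun p : ℝ × ℝ => relax h p.1 (max p.2 0)) = fun p : ℝ × ℝ =>
      ∫ r, (if 0 < r ∧ r ≤ max p.2 0 then Real.exp (-p.1 * (max p.2 0 - r)) * h r else 0) := by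
    ext p
    rw [relax, intervalIntegral.integral_of_le (le_max_right _ _),
      ← integral_indicator measurableSet_Ioc]
    refine integral_congr_ae (Filter.Eventually.of_forall fun r => ?_)
    simp only [indicator_apply, mem_Ioc]
  rw [this]
  refine (StronglyMeasurable.integral_prod_right (ν := volume) (f := fun (p : ℝ × ℝ) (r : ℝ) =>
    if 0 < r ∧ r ≤ max p.2 0 then Real.exp (-p.1 * (max p.2 0 - r)) * h r else 0)
    (Measurable.stronglyMeasurable ?_)).measurable
  refine Measurable.ite ?_ ?_ measurable_const
  · exact (measurableSet_lt measurable_const measurable_snd).inter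
      (measurableSet_le measurable_snd (by fun_prop))
  · fun_prop

theorem integrableOn_rpow_div_one_add {α : ℝ} (hα0 : 0 < α) (hα1 : α < 1) :
    IntegrableOn (fun l : ℝ => l ^ (-α) / (1 + l)) (Ioi 0) := by
  have hmeas : Measurable fun l : ℝ => l ^ (-α) / (1 + l) := by fun_prop
  rw [← Ioc_union_Ioi_eq_Ioi (zero_le_one' ℝ)]
  refine IntegrableOn.union ?_ ?_
  · have h1 : IntegrableOn (fun l : ℝ => l ^ (-α)) (Ioc 0 1) :=
      (intervalIntegrable_iff_integrableOn_Ioc_of_le zero_le_one).1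
        (intervalIntegral.intervalIntegrable_rpow' (by linarith))
    refine h1.mono' hmeas.aestronglyMeasurable ?_
    filter_upwards [ae_restrict_mem measurableSet_Ioc] with l hl
    have := Real.rpow_nonneg hl.1.le (-α)
    rw [Real.norm_eq_abs, abs_of_nonneg (div_nonneg this (by linarith [hl.1]))]
    exact div_le_self this (by linarith [hl.1])
  · have h1 : IntegrableOn (fun l : ℝ => l ^ (-α - 1)) (Ioi 1) :=
      integrableOn_Ioi_rpow_of_lt (by linarith) zero_lt_one
    refine h1.mono' hmeas.aestronglyMeasurable ?_
    filter_upwards [ae_restrict_mem measurableSet_Ioi] with l hl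
    have hl : 1 < l := hl
    have h0 : 0 < l := by linarith
    have := Real.rpow_nonneg h0.le (-α)
    rw [Real.norm_eq_abs, abs_of_nonneg (div_nonneg this (by linarith)),
      Real.rpow_sub_one h0.ne']
    gcongr
    linarith

theorem exists_integral_rpow_div_add_le {α : ℝ} (hα0 : 0 < α) (hα1 : α < 1) {ε : ℝ}
    (hε : 0 < ε) : ∃ g : ℝ, 1 ≤ g ∧ ∫ l in Ioi (0 : ℝ), l ^ (-α) / (g + l) ≤ ε := by
  have : Filter.Tendsto (fun g : ℝ => ∫ l in Ioi (0 : ℝ), l ^ (-α) / (g + l)) Filter.atTop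
      (nhds (∫ _ in Ioi (0 : ℝ), (0 : ℝ))) := by
    refine tendsto_integral_filter_of_dominated_convergence (fun l : ℝ => l ^ (-α) / (1 + l))
      ?_ ?_ (integrableOn_rpow_div_one_add hα0 hα1) ?_
    · exact Filter.Eventually.of_forall fun g =>
        (by fun_prop : Measurable fun l : ℝ => l ^ (-α) / (g + l)).aestronglyMeasurable
    · filter_upwards [Filter.eventually_ge_atTop 1] with g hg
      filter_upwards [ae_restrict_mem measurableSet_Ioi] with l hl
      have h0 : 0 < l := hl
      have := Real.rpow_nonneg h0.le (-α)
      rw [Real.norm_eq_abs, abs_of_nonneg (div_nonneg this (by linarith))]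
      gcongr
    · refine Filter.Eventually.of_forall fun l => ?_
      exact (Filter.tendsto_atTop_add_const_right _ l Filter.tendsto_id).const_div_atTop _
  rw [integral_zero] at this
  obtain ⟨g, h1, h2⟩ := ((this.eventually (ge_mem_nhds hε)).and
    (Filter.eventually_ge_atTop 1)).exists
  exact ⟨g, h2, h1⟩

theorem integral_rpow_mul_exp_neg {α : ℝ} (hα1 : α < 1) {x : ℝ} (hx : 0 < x) :
    ∫ l in Ioi (0 : ℝ), l ^ (-α) * Real.exp (-l * x) = Real.Gamma (1 - α) * x ^ (α - 1) := by
  have := Real.integral_rpow_mul_exp_neg_mul_Ioi (a := 1 - α) (r := x) (by linarith) hx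
  rw [one_div, Real.inv_rpow hx.le, ← Real.rpow_neg hx.le] at this
  rw [show -(1 - α) = α - 1 by ring, show 1 - α - 1 = -α by ring] at this
  rw [mul_comm, ← this]
  congr 1 with l
  ring_nf

/-- The Abel integral is a superposition of relaxations, by `integral_rpow_mul_exp_neg`. -/
theorem gamma_mul_abelIntegral {α : ℝ} (hα0 : 0 < α) (hα1 : α < 1) {h : ℝ → ℝ}
    (hm : Measurable h) {M : ℝ} (hM : ∀ s, |h s| ≤ M) {s : ℝ} (hs : 0 ≤ s) :
    Real.Gamma (1 - α) * abelIntegral α h s = ∫ l in Ioi (0 : ℝ), l ^ (-α) * relax h l s := by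
  have hF : Integrable (Function.uncurry fun r l : ℝ =>
      l ^ (-α) * Real.exp (-l * (s - r)) * h r)
      ((volume.restrict (Ioc 0 s)).prod (volume.restrict (Ioi 0))) := by
    have hmeas : Measurable (Function.uncurry fun r l : ℝ =>
      l ^ (-α) * Real.exp (-l * (s - r)) * h r) := by
      unfold Function.uncurry; fun_prop
    rw [integrable_prod_iff hmeas.aestronglyMeasurable]
    have hlt : ∀ᵐ r ∂(volume.restrict (Ioc 0 s)), r ∈ Ioo 0 s := by
      rw [← restrict_Ioo_eq_restrict_Ioc]
      exact ae_restrict_mem measurableSet_Ioo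
    constructor
    · filter_upwards [hlt] with r hr
      have hx : 0 < s - r := by linarith [hr.2]
      have := integrableOn_rpow_mul_exp_neg_mul_rpow (p := 1) (s := -α) (b := s - r)
        (by linarith) zero_lt_one hx
      refine (this.congr_fun (fun l hl => ?_) measurableSet_Ioi).mul_const (h r)
      simp only [Real.rpow_one]
      ring_nf
    · have hI : Integrable (fun r => Real.Gamma (1 - α) * ((s - r) ^ (α - 1) * M))
          (volume.restrict (Ioc 0 s)) := by
        refine Integrable.const_mul (Integrable.mul_const ?_ _) _
        refine (intervalIntegrable_iff_integrableOn_Ioc_of_le hs).1 ?_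
        have := (intervalIntegral.intervalIntegrable_rpow' (a := s) (b := 0) (r := α - 1)
          (by linarith)).comp_sub_left s
        simpa using this
      refine hI.mono' (hmeas.norm.stronglyMeasurable.integral_prod_right).aestronglyMeasurable ?_
      filter_upwards [hlt] with r hr
      have hx : 0 < s - r := by linarith [hr.2]
      have e : ∫ l in Ioi (0 : ℝ), ‖l ^ (-α) * Real.exp (-l * (s - r)) * h r‖
          = Real.Gamma (1 - α) * ((s - r) ^ (α - 1) * |h r|) := by
        rw [← mul_assoc, ← integral_rpow_mul_exp_neg hα1 hx, ← integral_mul_const]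
        refine setIntegral_congr_fun measurableSet_Ioi fun l hl => ?_
        have := Real.rpow_nonneg (le_of_lt hl) (-α)
        simp only [norm_mul, Real.norm_eq_abs, Real.abs_exp, abs_of_nonneg this]
      have e0 : 0 ≤ Real.Gamma (1 - α) := (Real.Gamma_pos_of_pos (by linarith)).le
      have e1 := Real.rpow_nonneg hx.le (α - 1)
      simp only [Function.uncurry]
      rw [e, Real.norm_eq_abs, abs_of_nonneg (by positivity)]
      gcongr
      exact hM r
  have := integral_integral_swap hF
  rw [abelIntegral, ← intervalIntegral.integral_const_mul, intervalIntegral.integral_of_le hs,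
    integral_Ioc_eq_integral_Ioo]
  rw [← restrict_Ioo_eq_restrict_Ioc] at this
  trans ∫ r in Ioo 0 s, ∫ l in Ioi (0 : ℝ), l ^ (-α) * Real.exp (-l * (s - r)) * h r
  · refine setIntegral_congr_fun measurableSet_Ioo fun r hr => ?_
    rw [integral_mul_const, integral_rpow_mul_exp_neg hα1 (by linarith [hr.2]), mul_assoc]
  · rw [this, restrict_Ioo_eq_restrict_Ioc]
    refine setIntegral_congr_fun measurableSet_Ioi fun l hl => ?_
    simp only [relax]
    rw [intervalIntegral.integral_of_le hs, ← integral_const_mul]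
    simp only [mul_assoc]

theorem integrable_mul_relax {α : ℝ} (hα0 : 0 < α) (hα1 : α < 1) {h : ℝ → ℝ}
    (hm : Measurable h) {M : ℝ} (hM : ∀ s, |h s| ≤ M) {T : ℝ} {q : ℝ → ℝ}
    (hq : AEStronglyMeasurable q (volume.restrict (Ioc 0 T))) {Q : ℝ}
    (hQ : ∀ᵐ s ∂(volume.restrict (Ioc 0 T)), |q s| ≤ Q) :
    Integrable (Function.uncurry fun s l : ℝ => q s * (l ^ (-α) * relax h l s))
      ((volume.restrict (Ioc 0 T)).prod (volume.restrict (Ioi 0))) := by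
  have hmem : ∀ᵐ p : ℝ × ℝ ∂((volume.restrict (Ioc 0 T)).prod (volume.restrict (Ioi 0))),
      p ∈ Ioc 0 T ×ˢ Ioi 0 := by
    rw [Measure.prod_restrict]
    exact ae_restrict_mem (measurableSet_Ioc.prod measurableSet_Ioi)
  have hq' : Integrable q (volume.restrict (Ioc 0 T)) :=
    (integrable_const Q).mono' hq hQ
  have hI := hq'.mul_prod
    ((integrableOn_rpow_div_one_add hα0 hα1).const_mul (M * (T + 1)))
  refine hI.mono ?_ ?_
  · refine AEStronglyMeasurable.congr (f := fun p : ℝ × ℝ =>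
      q p.1 * (p.2 ^ (-α) * relax h p.2 (max p.1 0))) ?_ ?_
    · refine hq.comp_fst.mul (Measurable.aestronglyMeasurable ?_)
      exact (measurable_snd.pow_const _).mul ((measurable_relax hm).comp measurable_swap)
    · filter_upwards [hmem] with p hp
      simp only [Function.uncurry]
      rw [max_eq_left hp.1.1.le]
  · filter_upwards [hmem] with p hp
    have hl : 0 < p.2 := hp.2
    have h1 := abs_relax_le hM hl.le ⟨hp.1.1.le, hp.1.2⟩
    have h2 := Real.rpow_nonneg hl.le (-α)
    simp only [Function.uncurry]
    rw [norm_mul, norm_mul (q p.1)]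
    refine mul_le_mul_of_nonneg_left ?_ (norm_nonneg _)
    rw [norm_mul, Real.norm_eq_abs, Real.norm_eq_abs, abs_of_nonneg h2]
    refine (mul_le_mul_of_nonneg_left h1 h2).trans ((le_of_eq ?_).trans (le_abs_self _))
    ring

theorem gamma_mul_integral_mul_abelIntegral {α : ℝ} (hα0 : 0 < α) (hα1 : α < 1) {h : ℝ → ℝ}
    (hm : Measurable h) {M : ℝ} (hM : ∀ s, |h s| ≤ M) {T : ℝ} {q : ℝ → ℝ}
    (hq : AEStronglyMeasurable q (volume.restrict (Ioc 0 T))) {Q : ℝ}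
    (hQ : ∀ᵐ s ∂(volume.restrict (Ioc 0 T)), |q s| ≤ Q) :
    Real.Gamma (1 - α) * ∫ s in Ioc 0 T, q s * abelIntegral α h s
      = ∫ l in Ioi (0 : ℝ), l ^ (-α) * ∫ s in Ioc 0 T, q s * relax h l s := by
  have := integral_integral_swap (integrable_mul_relax hα0 hα1 hm hM hq hQ)
  rw [← integral_const_mul]
  trans ∫ s in Ioc 0 T, ∫ l in Ioi (0 : ℝ), q s * (l ^ (-α) * relax h l s)
  · refine setIntegral_congr_fun measurableSet_Ioc fun s hs => ?_
    rw [integral_const_mul, ← gamma_mul_abelIntegral hα0 hα1 hm hM hs.1.le]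
    ring
  · rw [this]
    refine setIntegral_congr_fun measurableSet_Ioi fun l hl => ?_
    rw [← integral_const_mul]
    congr 1 with s
    ring

theorem aestronglyMeasurable_abelIntegral {α : ℝ} (hα0 : 0 < α) (hα1 : α < 1) {h : ℝ → ℝ}
    (hm : Measurable h) {M : ℝ} (hM : ∀ s, |h s| ≤ M) (T : ℝ) :
    AEStronglyMeasurable (abelIntegral α h) (volume.restrict (Ioc 0 T)) := by
  have hG : 0 < Real.Gamma (1 - α) := Real.Gamma_pos_of_pos (by linarith)
  refine AEStronglyMeasurable.congr (f := fun s : ℝ => (Real.Gamma (1 - α))⁻¹ *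
    ∫ l in Ioi (0 : ℝ), l ^ (-α) * relax h l (max s 0)) ?_ ?_
  · refine AEStronglyMeasurable.const_mul ?_ _
    refine (StronglyMeasurable.integral_prod_right (f := fun s l : ℝ =>
      l ^ (-α) * relax h l (max s 0)) (Measurable.stronglyMeasurable ?_)).aestronglyMeasurable
    exact (measurable_snd.pow_const _).mul ((measurable_relax hm).comp measurable_swap)
  · filter_upwards [ae_restrict_mem measurableSet_Ioc] with s hs
    rw [max_eq_left hs.1.le, ← gamma_mul_abelIntegral hα0 hα1 hm hM hs.1.le,
      inv_mul_cancel_left₀ hG.ne']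

theorem exists_abs_abelIntegral_le {α : ℝ} (hα0 : 0 < α) (hα1 : α < 1) {h : ℝ → ℝ}
    (hm : Measurable h) {M : ℝ} (hM : ∀ s, |h s| ≤ M) (T : ℝ) :
    ∃ B, ∀ s ∈ Ioc 0 T, |abelIntegral α h s| ≤ B := by
  have hG : 0 < Real.Gamma (1 - α) := Real.Gamma_pos_of_pos (by linarith)
  refine ⟨(∫ l in Ioi (0 : ℝ), M * (T + 1) * (l ^ (-α) / (1 + l))) / Real.Gamma (1 - α),
    fun s hs => ?_⟩
  rw [le_div_iff₀ hG, mul_comm, show Real.Gamma (1 - α) * |abelIntegral α h s|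
      = |Real.Gamma (1 - α) * abelIntegral α h s| by rw [abs_mul, abs_of_pos hG],
    gamma_mul_abelIntegral hα0 hα1 hm hM hs.1.le, ← Real.norm_eq_abs]
  refine norm_integral_le_of_norm_le
    ((integrableOn_rpow_div_one_add hα0 hα1).const_mul (M * (T + 1))) ?_
  filter_upwards [ae_restrict_mem measurableSet_Ioi] with l hl
  have hl : 0 < l := hl
  have h1 := abs_relax_le hM hl.le ⟨hs.1.le, hs.2⟩
  have h2 := Real.rpow_nonneg hl.le (-α)
  rw [norm_mul, Real.norm_eq_abs, Real.norm_eq_abs, abs_of_nonneg h2]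
  refine (mul_le_mul_of_nonneg_left h1 h2).trans (le_of_eq ?_)
  ring

/-- An exponential weight makes the quadratic form `h ↦ ∫ (I^α h) h` dominate any given multiple of
`∫ (I^α h)²`. The weight depends neither on the length `T` of the interval nor on the bound of
`h`. -/
theorem exists_weight_abelIntegral_coercive {α : ℝ} (hα0 : 0 < α) (hα1 : α < 1) {K : ℝ}
    (hK : 0 < K) : ∃ g : ℝ, 0 < g ∧ ∀ (T : ℝ) (h : ℝ → ℝ) (M : ℝ), 0 ≤ T → Measurable h →
      (∀ s, |h s| ≤ M) →
      K * ∫ s in Ioc 0 T, Real.exp (-(2 * g) * s) * abelIntegral α h s ^ 2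
        ≤ ∫ s in Ioc 0 T, Real.exp (-(2 * g) * s) * (abelIntegral α h s * h s) := by
  have hG : 0 < Real.Gamma (1 - α) := Real.Gamma_pos_of_pos (by linarith)
  obtain ⟨g, hg1, hgS⟩ := exists_integral_rpow_div_add_le hα0 hα1 (div_pos hG hK)
  refine ⟨g, by linarith, fun T h M hT hm hM => ?_⟩
  set k := abelIntegral α h with hk
  set e : ℝ → ℝ := fun s => Real.exp (-(2 * g) * s) with he
  obtain ⟨B, hB⟩ := exists_abs_abelIntegral_le hα0 hα1 hm hM T
  have km := aestronglyMeasurable_abelIntegral hα0 hα1 hm hM T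
  have em : Measurable e := by fun_prop
  have e1 : ∀ s ∈ Ioc 0 T, |e s| ≤ 1 := fun s hs => by
    rw [he, Real.abs_exp, Real.exp_le_one_iff]; nlinarith [hs.1]
  have mem : ∀ᵐ s ∂(volume.restrict (Ioc 0 T)), s ∈ Ioc 0 T := ae_restrict_mem measurableSet_Ioc
  have hBk : ∀ᵐ s ∂(volume.restrict (Ioc 0 T)), |e s * k s| ≤ B := by
    filter_upwards [mem] with s hs
    rw [abs_mul]
    exact (mul_le_mul (e1 s hs) (hB s hs) (abs_nonneg _) zero_le_one).trans (by simp)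
  have hMh : ∀ᵐ s ∂(volume.restrict (Ioc 0 T)), |e s * h s| ≤ M := by
    filter_upwards [mem] with s hs
    rw [abs_mul]
    exact (mul_le_mul (e1 s hs) (hM s) (abs_nonneg _) zero_le_one).trans (by simp)
  have ekm := em.aestronglyMeasurable.mul km
  have ehm := (em.mul hm).aestronglyMeasurable (μ := volume.restrict (Ioc 0 T))
  have f1 := gamma_mul_integral_mul_abelIntegral hα0 hα1 hm hM ehm hMh
  have f2 := gamma_mul_integral_mul_abelIntegral hα0 hα1 hm hM ekm hBk
  have j1 := (integrable_mul_relax hα0 hα1 hm hM ehm hMh).integral_prod_right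
  have j2 := (integrable_mul_relax hα0 hα1 hm hM ekm hBk).integral_prod_right
  have ikk : Integrable (fun s => e s * k s ^ 2) (volume.restrict (Ioc 0 T)) := by
    refine (integrable_const (B * B)).mono' (em.aestronglyMeasurable.mul (km.pow 2)) ?_
    filter_upwards [mem, hBk] with s hs hs'
    rw [pow_two, ← mul_assoc, norm_mul, Real.norm_eq_abs, Real.norm_eq_abs]
    exact mul_le_mul hs' (hB s hs) (abs_nonneg _) ((abs_nonneg _).trans hs')
  set Y := ∫ s in Ioc 0 T, e s * k s ^ 2 with hY
  have hY0 : 0 ≤ Y := integral_nonneg fun s => mul_nonneg (Real.exp_pos _).le (sq_nonneg _)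
  have jS : IntegrableOn (fun l : ℝ => l ^ (-α) / (g + l)) (Ioi 0) := by
    refine (integrableOn_rpow_div_one_add hα0 hα1).mono'
      (by fun_prop : Measurable fun l : ℝ => l ^ (-α) / (g + l)).aestronglyMeasurable ?_
    filter_upwards [ae_restrict_mem measurableSet_Ioi] with l hl
    have h0 : 0 < l := hl
    have := Real.rpow_nonneg h0.le (-α)
    rw [Real.norm_eq_abs, abs_of_nonneg (div_nonneg this (by linarith))]
    gcongr
  -- The estimate of a single relaxation, with Young's inequality for `p = K k(s)`.
  have key : ∀ l ∈ Ioi (0 : ℝ), 2 * K * (l ^ (-α) * ∫ s in Ioc 0 T, e s * k s * relax h l s)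
      - K ^ 2 * Y * (l ^ (-α) / (g + l))
      ≤ l ^ (-α) * ∫ s in Ioc 0 T, e s * h s * relax h l s := by
    intro l hl
    have hl : 0 < l := hl
    have h2 := Real.rpow_nonneg hl.le (-α)
    have hgl : 0 < g + l := by linarith
    have rm : AEStronglyMeasurable (relax h l) (volume.restrict (Ioc 0 T)) := by
      refine AEStronglyMeasurable.congr (f := fun s => relax h l (max s 0))
        ((measurable_relax hm).comp (f := fun s : ℝ => (l, s))
          (by fun_prop)).aestronglyMeasurable ?_
      filter_upwards [mem] with s hs
      rw [max_eq_left hs.1.le]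
    have rb : ∀ s ∈ Ioc 0 T, |relax h l s| ≤ M * (T + 1) / (1 + l) := fun s hs =>
      abs_relax_le hM hl.le ⟨hs.1.le, hs.2⟩
    have i1 : Integrable (fun s => e s * k s * relax h l s) (volume.restrict (Ioc 0 T)) := by
      refine (integrable_const (B * (M * (T + 1) / (1 + l)))).mono' (ekm.mul rm) ?_
      filter_upwards [mem, hBk] with s hs hs'
      rw [norm_mul]
      exact mul_le_mul hs' (rb s hs) (abs_nonneg _) ((abs_nonneg _).trans hs')
    have i2 : Integrable (fun s => e s * relax h l s ^ 2) (volume.restrict (Ioc 0 T)) := by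
      refine (integrable_const (1 * (M * (T + 1) / (1 + l)) ^ 2)).mono'
        (em.aestronglyMeasurable.mul (rm.pow 2)) ?_
      filter_upwards [mem] with s hs
      rw [norm_mul, norm_pow]
      exact mul_le_mul (e1 s hs) (pow_le_pow_left₀ (abs_nonneg _) (rb s hs) 2) (by positivity)
        zero_le_one
    have p1 := integral_exp_mul_relax_mul_ge T hm hM g l
    rw [intervalIntegral.integral_of_le hT, intervalIntegral.integral_of_le hT] at p1
    have p2 : ∫ s in Ioc 0 T, (2 * K * (e s * k s * relax h l s) - K ^ 2 / (g + l) * (e s * k s ^ 2))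
        ≤ ∫ s in Ioc 0 T, (g + l) * (e s * relax h l s ^ 2) := by
      refine integral_mono ((i1.const_mul _).sub (ikk.const_mul _)) (i2.const_mul _) fun s => ?_
      have : 0 ≤ e s / (g + l) * ((g + l) * relax h l s - K * k s) ^ 2 :=
        mul_nonneg (div_nonneg (Real.exp_pos _).le hgl.le) (sq_nonneg _)
      have e3 : e s / (g + l) * ((g + l) * relax h l s - K * k s) ^ 2
        = (g + l) * (e s * relax h l s ^ 2) - (2 * K * (e s * k s * relax h l s)
          - K ^ 2 / (g + l) * (e s * k s ^ 2)) := by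
        field_simp
        ring
      simp only
      linarith
    rw [integral_sub (i1.const_mul _) (ikk.const_mul _), integral_const_mul, integral_const_mul,
      integral_const_mul] at p2
    have p3 := mul_le_mul_of_nonneg_left (p2.trans p1) h2
    have e4 : ∫ s in Ioc 0 T, e s * h s * relax h l s
        = ∫ s in Ioc 0 T, Real.exp (-(2 * g) * s) * (relax h l s * h s) := by
      congr 1 with s
      simp only [he]; ring
    rw [e4]
    refine le_trans (le_of_eq ?_) p3
    rw [← hY]
    field_simp
  have hj : ∀ q : ℝ → ℝ, (fun l : ℝ => ∫ s in Ioc 0 T, q s * (l ^ (-α) * relax h l s))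
      = fun l => l ^ (-α) * ∫ s in Ioc 0 T, q s * relax h l s := fun q => by
    ext l
    rw [← integral_const_mul]
    congr 1 with s
    ring
  simp only [Function.uncurry_apply_pair] at j1 j2
  rw [hj] at j1
  rw [hj] at j2
  have p5 := setIntegral_mono_on ((j2.const_mul (2 * K)).sub (jS.const_mul (K ^ 2 * Y))) j1
    measurableSet_Ioi key
  rw [integral_sub' (j2.const_mul (2 * K)) (jS.const_mul (K ^ 2 * Y)), integral_const_mul,
    integral_const_mul, ← f1, ← f2] at p5
  have e5 : ∫ s in Ioc 0 T, e s * k s * k s = Y := by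
    rw [hY]; congr 1 with s; ring
  have e6 : ∫ s in Ioc 0 T, e s * h s * k s = ∫ s in Ioc 0 T, e s * (k s * h s) := by
    congr 1 with s; ring
  simp only [Pi.mul_apply] at p5
  rw [← hk, e5, e6] at p5
  rw [le_div_iff₀ hK] at hgS
  have p6 := mul_le_mul_of_nonneg_left hgS (mul_nonneg hK.le hY0)
  refine le_of_mul_le_mul_left ?_ hG
  nlinarith

/-! ### Inversion of Riemann--Liouville derivatives -/

open scoped Convolution in
/-- Convolutions of functions truncated to `(0, T]` are Volterra convolutions up to time `T`. -/
theorem convolution_indicator_of_mem {T t : ℝ} (ht : t ∈ Icc 0 T) (f g : ℝ → ℝ) :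
    ((Ioc 0 T).indicator f ⋆[ContinuousLinearMap.mul ℝ ℝ, volume] (Ioc 0 T).indicator g) t
      = ∫ s in (0 : ℝ)..t, f s * g (t - s) := by
  rw [convolution_mul, intervalIntegral.integral_of_le ht.1, integral_Ioc_eq_integral_Ioo,
    ← integral_indicator measurableSet_Ioo]
  congr 1 with s
  by_cases hs : s ∈ Ioo 0 t
  · have h1 : s ∈ Ioc 0 T := ⟨hs.1, hs.2.le.trans ht.2⟩
    have h2 : t - s ∈ Ioc 0 T := ⟨by linarith [hs.2], by linarith [hs.1, ht.2]⟩
    rw [indicator_of_mem hs, indicator_of_mem h1, indicator_of_mem h2]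
  · rw [indicator_of_notMem hs]
    by_cases h1 : s ∈ Ioc 0 T
    · have h2 : t - s ∉ Ioc 0 T := fun h2 => hs ⟨h1.1, by linarith [h2.1]⟩
      rw [indicator_of_notMem h2, mul_zero]
    · rw [indicator_of_notMem h1, zero_mul]

open scoped Convolution in
theorem convolution_indicator_of_nonpos {T t : ℝ} (ht : t ≤ 0) (f g : ℝ → ℝ) :
    ((Ioc 0 T).indicator f ⋆[ContinuousLinearMap.mul ℝ ℝ, volume] (Ioc 0 T).indicator g) t
      = 0 := by
  rw [convolution_mul]
  refine integral_eq_zero_of_ae (Filter.Eventually.of_forall fun s => ?_)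
  by_cases h1 : s ∈ Ioc 0 T
  · have h2 : t - s ∉ Ioc 0 T := fun h2 => by linarith [h1.1, h2.1]
    simp [indicator_of_notMem h2]
  · simp [indicator_of_notMem h1]

open scoped Convolution in
/-- The value at `t ≤ T` of a convolution with a function supported in `(0, T]` depends only on
the values of the other factor up to `T`. -/
theorem convolution_indicator_congr_left {T t : ℝ} (ht : t ≤ T) {F F' : ℝ → ℝ} (g : ℝ → ℝ)
    (h : ∀ s ≤ T, F s = F' s) :
    (F ⋆[ContinuousLinearMap.mul ℝ ℝ, volume] (Ioc 0 T).indicator g) t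
      = (F' ⋆[ContinuousLinearMap.mul ℝ ℝ, volume] (Ioc 0 T).indicator g) t := by
  rw [convolution_mul, convolution_mul]
  congr 1 with s
  by_cases hs : s ≤ T
  · rw [h s hs]
  · have h2 : t - s ∉ Ioc 0 T := fun h2 => by linarith [h2.1]
    rw [indicator_of_notMem h2, mul_zero, mul_zero]

open scoped Convolution in
theorem convolution_mul_comm (F G : ℝ → ℝ) :
    F ⋆[ContinuousLinearMap.mul ℝ ℝ, volume] G = G ⋆[ContinuousLinearMap.mul ℝ ℝ, volume] F := by
  ext t
  rw [convolution_mul_swap, convolution_mul]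
  congr 1 with s
  ring

open scoped Convolution in
theorem convolution_mul_assoc_ae {F G K : ℝ → ℝ} (hF : Integrable F) (hG : Integrable G)
    (hK : Integrable K) : ∀ᵐ t,
    ((F ⋆[ContinuousLinearMap.mul ℝ ℝ, volume] G) ⋆[ContinuousLinearMap.mul ℝ ℝ, volume] K) t
      = (F ⋆[ContinuousLinearMap.mul ℝ ℝ, volume]
          (G ⋆[ContinuousLinearMap.mul ℝ ℝ, volume] K)) t := by
  have hGK := hG.norm.integrable_convolution (ContinuousLinearMap.mul ℝ ℝ) hK.norm
  filter_upwards [hF.norm.ae_convolution_exists (ContinuousLinearMap.mul ℝ ℝ) hGK] with t ht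
  refine convolution_assoc _ _ _ _ (fun x y z => ?_) hF.aestronglyMeasurable
    hG.aestronglyMeasurable hK.aestronglyMeasurable
    (hF.ae_convolution_exists _ hG) (hG.norm.ae_convolution_exists _ hK.norm) ht
  simp [mul_assoc]

theorem integral_rpow_mul_one_sub_rpow {α : ℝ} (hα0 : 0 < α) (hα1 : α < 1) :
    ∫ s in (0 : ℝ)..1, s ^ (-α) * (1 - s) ^ (α - 1) = Real.Gamma (1 - α) * Real.Gamma α := by
  have h := ProbabilityTheory.beta_eq_betaIntegralReal (1 - α) α (by linarith) hα0
  rw [ProbabilityTheory.beta, sub_add_cancel, Real.Gamma_one, div_one] at h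
  have e : Complex.betaIntegral ((1 - α : ℝ) : ℂ) α
      = ((∫ s in (0 : ℝ)..1, s ^ (-α) * (1 - s) ^ (α - 1) : ℝ) : ℂ) := by
    rw [Complex.betaIntegral, ← intervalIntegral.integral_ofReal]
    refine intervalIntegral.integral_congr fun s hs => ?_
    rw [uIcc_of_le zero_le_one] at hs
    have h1 : (0 : ℝ) ≤ 1 - s := by linarith [hs.2]
    push_cast
    rw [Complex.ofReal_cpow hs.1, Complex.ofReal_cpow h1]
    push_cast
    ring_nf
  rw [h, e, Complex.ofReal_re]

theorem integral_rpow_mul_sub_rpow {α : ℝ} (hα0 : 0 < α) (hα1 : α < 1) {t : ℝ} (ht : 0 < t) :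
    ∫ s in (0 : ℝ)..t, s ^ (-α) * (t - s) ^ (α - 1) = Real.Gamma (1 - α) * Real.Gamma α := by
  have h := intervalIntegral.mul_integral_comp_mul_left (a := 0) (b := 1)
    (f := fun s => s ^ (-α) * (t - s) ^ (α - 1)) t
  rw [mul_zero, mul_one] at h
  rw [← h, ← integral_rpow_mul_one_sub_rpow hα0 hα1, ← intervalIntegral.integral_const_mul]
  refine intervalIntegral.integral_congr fun s hs => ?_
  rw [uIcc_of_le zero_le_one] at hs
  have h1 : (0 : ℝ) ≤ 1 - s := by linarith [hs.2]
  rw [show t - t * s = t * (1 - s) by ring, Real.mul_rpow ht.le hs.1, Real.mul_rpow ht.le h1]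
  have : t * (t ^ (-α) * t ^ (α - 1)) = 1 := by
    rw [← Real.rpow_add ht, show -α + (α - 1) = -1 by ring, Real.rpow_neg_one,
      mul_inv_cancel₀ ht.ne']
  linear_combination (s ^ (-α) * (1 - s) ^ (α - 1)) * this

theorem ae_eq_zero_of_forall_integral_eq_zero {T : ℝ} {f : ℝ → ℝ}
    (hf : IntervalIntegrable f volume 0 T)
    (h : ∀ᵐ t, t ∈ Ioc 0 T → ∫ s in (0 : ℝ)..t, f s = 0) :
    ∀ᵐ t, t ∈ Ioo 0 T → f t = 0 := by
  rcases le_or_gt T 0 with hT | hT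
  · exact Filter.Eventually.of_forall fun t ht => by linarith [ht.1, ht.2]
  have hc : ContinuousOn (fun t => ∫ s in (0 : ℝ)..t, f s) (Ioo 0 T) := by
    have := (hf.absolutelyContinuousOnInterval_intervalIntegral (c := 0) (by simp)).continuousOn
    rw [uIcc_of_le hT.le] at this
    exact this.mono Ioo_subset_Icc_self
  have hz : EqOn (fun t => ∫ s in (0 : ℝ)..t, f s) (fun _ => 0) (Ioo 0 T) := by
    refine Measure.eqOn_open_of_ae_eq (μ := volume) ?_ isOpen_Ioo hc continuousOn_const
    rw [Filter.EventuallyEq, ae_restrict_iff' measurableSet_Ioo]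
    filter_upwards [h] with t ht ht' using ht (Ioo_subset_Ioc_self ht')
  filter_upwards [hf.ae_hasDerivAt_integral] with t ht ht'
  rw [uIcc_of_le hT.le] at ht
  have h1 := ht (Ioo_subset_Icc_self ht') 0 (left_mem_Icc.2 hT.le)
  have h2 : HasDerivAt (fun t => ∫ s in (0 : ℝ)..t, f s) 0 t :=
    (hasDerivAt_const t (0 : ℝ)).congr_of_eventuallyEq
      (Filter.eventuallyEq_of_mem (isOpen_Ioo.mem_nhds ht') hz)
  exact h1.unique h2

open scoped Convolution in
/-- `I^α D^α x = x` almost everywhere, written without the factor `Γ(α)⁻¹` of `I^α`. -/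
theorem ae_eq_abelIntegral_rlDeriv {α T : ℝ} (hα0 : 0 < α) (hα1 : α < 1) (hT : 0 < T)
    {x : ℝ → ℝ} (hx : ContinuousOn x (Icc 0 T)) (hac : HasRLDeriv α T x) :
    ∀ᵐ t, t ∈ Ioo 0 T → Real.Gamma α * x t = abelIntegral α (rlDeriv α x) t := by
  have hG : 0 < Real.Gamma (1 - α) := Real.Gamma_pos_of_pos (by linarith)
  set h := rlDeriv α x with hh
  have ih : IntervalIntegrable h volume 0 T := hac.intervalIntegrable_deriv
  have ftc : ∀ t ∈ Icc 0 T, ∫ s in (0 : ℝ)..t, h s = rlIntegral (1 - α) x t := fun t ht => by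
    have := (hac.mono (c := 0) (d := t) (by
      rw [uIcc_of_le ht.1, uIcc_of_le hT.le]; exact Icc_subset_Icc_right ht.2)).integral_deriv_eq_sub
    have h0 : rlIntegral (1 - α) x 0 = 0 := by simp [rlIntegral]
    rw [h0, sub_zero] at this
    exact this
  have ind : ∀ {f : ℝ → ℝ}, IntervalIntegrable f volume 0 T →
      Integrable ((Ioc 0 T).indicator f) := fun hf =>
    (integrable_indicator_iff measurableSet_Ioc).2
      ((intervalIntegrable_iff_integrableOn_Ioc_of_le hT.le).1 hf)
  have ix : IntervalIntegrable x volume 0 T := by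
    refine ContinuousOn.intervalIntegrable ?_
    rwa [uIcc_of_le hT.le]
  have iA : IntervalIntegrable (fun s : ℝ => s ^ (α - 1)) volume 0 T :=
    intervalIntegral.intervalIntegrable_rpow' (by linarith)
  have iB : IntervalIntegrable (fun s : ℝ => s ^ (-α)) volume 0 T :=
    intervalIntegral.intervalIntegrable_rpow' (by linarith)
  have iU : IntervalIntegrable (fun _ : ℝ => (1 : ℝ)) volume 0 T := intervalIntegrable_const
  set X := (Ioc 0 T).indicator x with hX
  set H := (Ioc 0 T).indicator h with hH
  set A := (Ioc 0 T).indicator (fun s : ℝ => s ^ (α - 1)) with hA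
  set B := (Ioc 0 T).indicator (fun s : ℝ => s ^ (-α)) with hB
  set U := (Ioc 0 T).indicator (fun _ : ℝ => (1 : ℝ)) with hU
  set L := ContinuousLinearMap.mul ℝ ℝ with hL
  -- This is `Γ(1-α) I^{1-α} x = Γ(1-α) ∫ D^α x`.
  have eXB : ∀ t ≤ T, (X ⋆[L, volume] B) t = Real.Gamma (1 - α) * (H ⋆[L, volume] U) t := by
    intro t ht
    rcases le_or_gt t 0 with h0 | h0
    · rw [convolution_indicator_of_nonpos h0, convolution_indicator_of_nonpos h0, mul_zero]
    · rw [convolution_indicator_of_mem ⟨h0.le, ht⟩, convolution_indicator_of_mem ⟨h0.le, ht⟩]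
      simp only [mul_one]
      rw [ftc t ⟨h0.le, ht⟩, rlIntegral, smul_eq_mul, mul_inv_cancel_left₀ hG.ne']
      refine intervalIntegral.integral_congr fun s _ => ?_
      simp only [smul_eq_mul]
      rw [show 1 - α - 1 = -α by ring, mul_comm]
  have eBA : ∀ t ≤ T, (B ⋆[L, volume] A) t = Real.Gamma (1 - α) * Real.Gamma α * U t := by
    intro t ht
    rcases le_or_gt t 0 with h0 | h0
    · rw [convolution_indicator_of_nonpos h0, hU, indicator_of_notMem (fun h1 => h1.1.not_ge h0),
        mul_zero]
    · rw [convolution_indicator_of_mem ⟨h0.le, ht⟩, integral_rpow_mul_sub_rpow hα0 hα1 h0, hU,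
        indicator_of_mem (show t ∈ Ioc 0 T from ⟨h0, ht⟩), mul_one]
  have sm : ∀ (r : ℝ) (F G : ℝ → ℝ) (t : ℝ),
      ((fun s => r * F s) ⋆[L, volume] G) t = r * (F ⋆[L, volume] G) t := fun r F G t => by
    rw [hL, convolution_mul, convolution_mul, ← integral_const_mul]
    congr 1 with s
    ring
  have iHA : Integrable (H ⋆[L, volume] A) := (ind ih).integrable_convolution L (ind iA)
  -- Associativity turns `(X * B) * A = X * (B * A)` into an identity of primitives.
  have main : ∀ᵐ t, t ∈ Ioc 0 T →
      Real.Gamma α * (X ⋆[L, volume] U) t = ((H ⋆[L, volume] A) ⋆[L, volume] U) t := by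
    filter_upwards [convolution_mul_assoc_ae (ind ix) (ind iB) (ind iA),
      convolution_mul_assoc_ae (ind ih) (ind iU) (ind iA),
      convolution_mul_assoc_ae (ind ih) (ind iA) (ind iU)] with t a1 a2 a3 ht
    rw [convolution_indicator_congr_left ht.2 _ eXB, sm, a2, convolution_mul_comm U A, ← a3,
      convolution_mul_comm X, convolution_indicator_congr_left ht.2 _ eBA, sm,
      convolution_mul_comm U X] at a1
    refine mul_left_cancel₀ hG.ne' ?_
    rw [← mul_assoc]
    exact a1.symm
  have key := ae_eq_zero_of_forall_integral_eq_zero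
    (f := fun s => Real.Gamma α * x s - (H ⋆[L, volume] A) s) (T := T)
    ((ix.const_mul _).sub iHA.intervalIntegrable) ?_
  · filter_upwards [key] with t ht ht'
    rw [sub_eq_zero.1 (ht ht'), convolution_indicator_of_mem (Ioo_subset_Icc_self ht'),
      abelIntegral]
    simp only [mul_comm]
  · filter_upwards [main] with t ht ht'
    rw [intervalIntegral.integral_sub ((ix.mono_set (by
      rw [uIcc_of_le ht'.1.le, uIcc_of_le hT.le]; exact Icc_subset_Icc_right ht'.2)).const_mul _)
      iHA.intervalIntegrable, intervalIntegral.integral_const_mul, sub_eq_zero]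
    have e1 := ht ht'
    rw [convolution_indicator_of_mem ⟨ht'.1.le, ht'.2⟩] at e1
    simp only [mul_one] at e1
    have e2 : ((H ⋆[L, volume] A) ⋆[L, volume] U) t
        = ((Ioc 0 T).indicator (H ⋆[L, volume] A) ⋆[L, volume] U) t := by
      refine convolution_indicator_congr_left ht'.2 _ fun s hs => ?_
      rcases le_or_gt s 0 with h0 | h0
      · rw [convolution_indicator_of_nonpos h0, indicator_of_notMem (fun h1 => h1.1.not_ge h0)]
      · rw [indicator_of_mem (show s ∈ Ioc 0 T from ⟨h0, hs⟩)]
    rw [e2, convolution_indicator_of_mem ⟨ht'.1.le, ht'.2⟩] at e1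
    simpa only [mul_one] using e1

/-! ### The form at almost every time -/

theorem ae_norm_le_toReal_eLpNorm_top {X F : Type*} [MeasurableSpace X] [NormedAddCommGroup F]
    {μ : Measure X} {f : X → F} (hf : MemLp f ∞ μ) :
    ∀ᵐ x ∂μ, ‖f x‖ ≤ (eLpNorm f ∞ μ).toReal := by
  have h := hf.eLpNorm_ne_top
  rw [eLpNorm_exponent_top] at h ⊢
  filter_upwards [ae_le_eLpNormEssSup (f := f) (μ := μ)] with x hx
  rw [← toReal_enorm]
  exact ENNReal.toReal_mono h hx

/-- The integrand of `form` at a point: `a`, `b`, `c` are the values of the coefficients, `p`, `z`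
those of `Du`, `u`, and `q`, `y` those of `Dv`, `v`. -/
def formDensity {d : ℕ} (a : Fin d → Fin d → ℝ) (b : Fin d → ℝ) (c : ℝ) (p : Euc d) (z : ℝ)
    (q : Euc d) (y : ℝ) : ℝ :=
  (∑ i, ∑ j, a i j * p j * q i) + (∑ j, b j * p j * y) + c * z * y

theorem abs_coord_le {d : ℕ} (p : Euc d) (i : Fin d) : |p i| ≤ ‖p‖ := PiLp.norm_apply_le p i

theorem abs_sum_le_of_forall {d : ℕ} {f : Fin d → ℝ} {B : ℝ} (h : ∀ i, |f i| ≤ B) :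
    |∑ i, f i| ≤ d * B := by
  refine (Finset.abs_sum_le_sum_abs _ _).trans ((Finset.sum_le_sum fun i _ => h i).trans ?_)
  simp

theorem abs_firstOrder_le {d : ℕ} {b : Fin d → ℝ} {A : ℝ} (hb : ∀ j, |b j| ≤ A) (p : Euc d)
    (y : ℝ) : |∑ j, b j * p j * y| ≤ d * (A * ‖p‖ * |y|) := by
  refine abs_sum_le_of_forall fun j => ?_
  rw [abs_mul, abs_mul]
  have hA : 0 ≤ A := (abs_nonneg _).trans (hb j)
  gcongr
  · exact hb j
  · exact abs_coord_le p j

theorem abs_formDensity_le {d : ℕ} {a : Fin d → Fin d → ℝ} {b : Fin d → ℝ} {c A : ℝ}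
    (ha : ∀ i j, |a i j| ≤ A) (hb : ∀ j, |b j| ≤ A) (hc : |c| ≤ A) (p : Euc d) (z : ℝ)
    (q : Euc d) (y : ℝ) :
    |formDensity a b c p z q y| ≤ (d * d + d + 1) * A * ((‖p‖ + |z|) * (‖q‖ + |y|)) := by
  have hA : 0 ≤ A := (abs_nonneg _).trans hc
  have h1 : |∑ i, ∑ j, a i j * p j * q i| ≤ d * (d * (A * ‖p‖ * ‖q‖)) := by
    refine abs_sum_le_of_forall fun i => abs_sum_le_of_forall fun j => ?_
    rw [abs_mul, abs_mul]
    gcongr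
    · exact ha i j
    · exact abs_coord_le p j
    · exact abs_coord_le q i
  have h2 := abs_firstOrder_le hb p y
  have h3 : |c * z * y| ≤ A * |z| * |y| := by
    rw [abs_mul, abs_mul]
    gcongr
  have h4 := abs_add_three (∑ i, ∑ j, a i j * p j * q i) (∑ j, b j * p j * y) (c * z * y)
  rw [formDensity]
  have hp := norm_nonneg p
  have hq := norm_nonneg q
  have hz := abs_nonneg z
  have hy := abs_nonneg y
  have hd : (0 : ℝ) ≤ d := Nat.cast_nonneg d
  have e : ((d : ℝ) * d + d + 1) * A * ((‖p‖ + |z|) * (‖q‖ + |y|))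
      = d * (d * (A * ‖p‖ * ‖q‖)) + d * (A * ‖p‖ * |y|) + A * |z| * |y|
        + (d * d * A * (‖p‖ * |y| + |z| * ‖q‖ + |z| * |y|)
          + d * A * (‖p‖ * ‖q‖ + |z| * ‖q‖ + |z| * |y|)
          + A * (‖p‖ * ‖q‖ + ‖p‖ * |y| + |z| * ‖q‖)) := by ring
  have : 0 ≤ (d * d * A * (‖p‖ * |y| + |z| * ‖q‖ + |z| * |y|)
          + d * A * (‖p‖ * ‖q‖ + |z| * ‖q‖ + |z| * |y|)
          + A * (‖p‖ * ‖q‖ + ‖p‖ * |y| + |z| * ‖q‖)) := by positivity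
  rw [e]
  linarith

theorem le_formDensity_self {d : ℕ} {a : Fin d → Fin d → ℝ} {b : Fin d → ℝ} {c A θ : ℝ}
    (hθ : 0 < θ) (hb : ∀ j, |b j| ≤ A) (hc : |c| ≤ A) {p : Euc d}
    (ha : θ * ‖p‖ ^ 2 ≤ ∑ i, ∑ j, a i j * p i * p j) (z : ℝ) :
    θ / 2 * ‖p‖ ^ 2 - ((d * A) ^ 2 / (2 * θ) + A) * z ^ 2 ≤ formDensity a b c p z p z := by
  have h2 := (abs_le.1 (abs_firstOrder_le hb p z)).1
  have h3 : -(A * z ^ 2) ≤ c * z * z := by nlinarith [(abs_le.1 hc).1, sq_nonneg z]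
  have h4 : ∑ i, ∑ j, a i j * p j * p i = ∑ i, ∑ j, a i j * p i * p j :=
    Finset.sum_congr rfl fun i _ => Finset.sum_congr rfl fun j _ => by ring
  have h5 : (d : ℝ) * (A * ‖p‖ * |z|) ≤ θ / 2 * ‖p‖ ^ 2 + (d * A) ^ 2 / (2 * θ) * z ^ 2 := by
    have : 0 ≤ 1 / (2 * θ) * (θ * ‖p‖ - d * A * |z|) ^ 2 := by positivity
    have e : 1 / (2 * θ) * (θ * ‖p‖ - d * A * |z|) ^ 2
      = θ / 2 * ‖p‖ ^ 2 + (d * A) ^ 2 / (2 * θ) * |z| ^ 2 - d * (A * ‖p‖ * |z|) := by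
      field_simp
      ring
    rw [e, sq_abs] at this
    linarith
  rw [formDensity, h4]
  linarith

theorem norm_sq_H10 {d : ℕ} {Ω : Set (Euc d)} (u : H10 Ω) :
    ‖u‖ ^ 2 = ‖toL2 Ω u‖ ^ 2 + ‖grad Ω u‖ ^ 2 :=
  WithLp.prod_norm_sq_eq_of_L2 (u : L2Pair Ω)

theorem inner_H10 {d : ℕ} {Ω : Set (Euc d)} (u v : H10 Ω) :
    inner ℝ u v = inner ℝ (toL2 Ω u) (toL2 Ω v) + inner ℝ (grad Ω u) (grad Ω v) :=
  WithLp.prod_inner_apply (u : L2Pair Ω) (v : L2Pair Ω)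

theorem norm_toL2_le {d : ℕ} {Ω : Set (Euc d)} (u : H10 Ω) : ‖toL2 Ω u‖ ≤ ‖u‖ := by
  refine (sq_le_sq₀ (norm_nonneg _) (norm_nonneg u)).1 ?_
  rw [norm_sq_H10 u]
  linarith [sq_nonneg ‖grad Ω u‖]

theorem norm_sq_Lp_two {X F : Type*} [MeasurableSpace X] [NormedAddCommGroup F]
    [InnerProductSpace ℝ F] {μ : Measure X} (f : Lp F 2 μ) : ‖f‖ ^ 2 = ∫ x, ‖f x‖ ^ 2 ∂μ := by
  rw [← real_inner_self_eq_norm_sq, L2.inner_def]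
  simp only [real_inner_self_eq_norm_sq]

theorem integrable_norm_sq {X F : Type*} [MeasurableSpace X] [NormedAddCommGroup F]
    {μ : Measure X} (f : Lp F 2 μ) : Integrable (fun x => ‖f x‖ ^ 2) μ :=
  (Lp.memLp f).integrable_norm_pow (by norm_num)

/-- `|Du(x)| + |u(x)|`. -/
noncomputable def jetNorm {d : ℕ} {Ω : Set (Euc d)} (u : H10 Ω) (x : Euc d) : ℝ :=
  ‖grad Ω u x‖ + |toL2 Ω u x|

theorem memLp_jetNorm {d : ℕ} {Ω : Set (Euc d)} (u : H10 Ω) :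
    MemLp (jetNorm u) 2 (volume.restrict Ω) :=
  (Lp.memLp (grad Ω u)).norm.add (Lp.memLp (toL2 Ω u)).norm

theorem integral_jetNorm_sq_le {d : ℕ} {Ω : Set (Euc d)} (u : H10 Ω) :
    ∫ x in Ω, jetNorm u x ^ 2 ≤ 2 * ‖u‖ ^ 2 := by
  have h1 := integrable_norm_sq (toL2 Ω u)
  have h2 := integrable_norm_sq (grad Ω u)
  rw [norm_sq_H10, norm_sq_Lp_two, norm_sq_Lp_two, ← integral_add h1 h2, ← integral_const_mul]
  refine integral_mono (memLp_jetNorm u).integrable_sq ((h1.add h2).const_mul 2) fun x => ?_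
  simp only [jetNorm, Real.norm_eq_abs]
  nlinarith [sq_nonneg (‖grad Ω u x‖ - |toL2 Ω u x|)]

theorem integral_jetNorm_mul_le {d : ℕ} {Ω : Set (Euc d)} (u v : H10 Ω) :
    ∫ x in Ω, jetNorm u x * jetNorm v x ≤ 2 * ‖u‖ * ‖v‖ := by
  have hn : ∀ (w : H10 Ω) (x : Euc d), 0 ≤ jetNorm w x := fun w x =>
    add_nonneg (norm_nonneg _) (abs_nonneg _)
  have h := integral_mul_le_Lp_mul_Lq_of_nonneg (μ := volume.restrict Ω) Real.HolderConjugate.two_two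
    (Filter.Eventually.of_forall (hn u)) (Filter.Eventually.of_forall (hn v))
    (by simpa using memLp_jetNorm u) (by simpa using memLp_jetNorm v)
  simp only [Real.rpow_two, ← Real.sqrt_eq_rpow] at h
  refine h.trans ?_
  have hs : ∀ w : H10 Ω, √(∫ x in Ω, jetNorm w x ^ 2) ≤ √2 * ‖w‖ := fun w => by
    rw [Real.sqrt_le_left (by positivity), mul_pow, Real.sq_sqrt zero_le_two]
    exact integral_jetNorm_sq_le w
  refine (mul_le_mul (hs u) (hs v) (Real.sqrt_nonneg _) (by positivity)).trans (le_of_eq ?_)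
  linear_combination ‖u‖ * ‖v‖ * Real.mul_self_sqrt (zero_le_two (α := ℝ))

/-- At time `t` the coefficients, as functions on `Ω`, are measurable, bounded by `A`, and elliptic
with constant `θ`. By Fubini's theorem this holds for almost every `t`. -/
structure IsRegularTime {d : ℕ} (Ω : Set (Euc d)) (a : Fin d → Fin d → ℝ × Euc d → ℝ)
    (b : Fin d → ℝ × Euc d → ℝ) (c : ℝ × Euc d → ℝ) (A θ t : ℝ) : Prop where
  meas_a : ∀ i j, AEStronglyMeasurable (fun x => a i j (t, x)) (volume.restrict Ω)
  meas_b : ∀ j, AEStronglyMeasurable (fun x => b j (t, x)) (volume.restrict Ω)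
  meas_c : AEStronglyMeasurable (fun x => c (t, x)) (volume.restrict Ω)
  bound_a : ∀ᵐ x ∂(volume.restrict Ω), ∀ i j, |a i j (t, x)| ≤ A
  bound_b : ∀ᵐ x ∂(volume.restrict Ω), ∀ j, |b j (t, x)| ≤ A
  bound_c : ∀ᵐ x ∂(volume.restrict Ω), |c (t, x)| ≤ A
  elliptic : ∀ᵐ x ∂(volume.restrict Ω), ∀ ξ : Euc d,
    θ * ‖ξ‖ ^ 2 ≤ ∑ i, ∑ j, a i j (t, x) * ξ i * ξ j

section
variable {d : ℕ} {Ω : Set (Euc d)} {a : Fin d → Fin d → ℝ × Euc d → ℝ}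
  {b : Fin d → ℝ × Euc d → ℝ} {c : ℝ × Euc d → ℝ}

theorem form_eq_integral_formDensity (u v : H10 Ω) (t : ℝ) :
    form Ω a b c u v t = ∫ x in Ω, formDensity (fun i j => a i j (t, x)) (fun j => b j (t, x))
      (c (t, x)) (grad Ω u x) (toL2 Ω u x) (grad Ω v x) (toL2 Ω v x) := rfl

theorem form_smul_right (t r : ℝ) (u v : H10 Ω) :
    form Ω a b c u (r • v) t = r * form Ω a b c u v t := by
  simp only [form_eq_integral_formDensity]
  rw [← integral_const_mul]
  refine integral_congr_ae ?_
  rw [map_smul, map_smul]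
  filter_upwards [Lp.coeFn_smul r (grad Ω v), Lp.coeFn_smul r (toL2 Ω v)] with x h1 h2
  rw [h1, h2]
  simp only [formDensity, Pi.smul_apply, PiLp.smul_apply, smul_eq_mul, mul_add, Finset.mul_sum]
  congr 1
  · congr 1
    · exact Finset.sum_congr rfl fun i _ => Finset.sum_congr rfl fun j _ => by ring
    · exact Finset.sum_congr rfl fun j _ => by ring
  · ring

theorem IsAdmissible.exists_ae_isRegularTime {T : ℝ} (hcoef : IsAdmissible Ω T a b c) :
    ∃ A θ : ℝ, 0 ≤ A ∧ 0 < θ ∧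
      ∀ᵐ t ∂(volume.restrict (Ioo 0 T)), IsRegularTime Ω a b c A θ t := by
  obtain ⟨θ, hθ, hell⟩ := hcoef.elliptic
  have hAa := fun i j => ae_norm_le_toReal_eLpNorm_top (hcoef.memLp_a i j)
  have hAb := fun j => ae_norm_le_toReal_eLpNorm_top (hcoef.memLp_b j)
  have hAc := ae_norm_le_toReal_eLpNorm_top hcoef.memLp_c
  set Aa := fun i j => (eLpNorm (a i j) ∞ (cylMeasure Ω T)).toReal
  set Ab := fun j => (eLpNorm (b j) ∞ (cylMeasure Ω T)).toReal
  set Ac := (eLpNorm c ∞ (cylMeasure Ω T)).toReal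
  have hcyl : cylMeasure Ω T = (volume.restrict (Ioo 0 T)).prod (volume.restrict Ω) := by
    rw [restrict_Ioo_eq_restrict_Ioc, Measure.prod_restrict]
    rfl
  have hmeas : ∀ {f : ℝ × Euc d → ℝ}, MemLp f ∞ (cylMeasure Ω T) →
      ∀ᵐ t ∂(volume.restrict (Ioo 0 T)),
        AEStronglyMeasurable (fun x => f (t, x)) (volume.restrict Ω) := fun hf => by
    have := hf.aestronglyMeasurable
    rw [hcyl] at this
    exact this.prodMk_left
  have hae : ∀ {p : ℝ × Euc d → Prop}, (∀ᵐ z ∂(cylMeasure Ω T), p z) →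
      ∀ᵐ t ∂(volume.restrict (Ioo 0 T)), ∀ᵐ x ∂(volume.restrict Ω), p (t, x) := fun hp => by
    rw [hcyl] at hp
    exact Measure.ae_ae_of_ae_prod hp
  refine ⟨(∑ i, ∑ j, |Aa i j|) + ∑ j, |Ab j| + |Ac|, θ, by positivity, hθ, ?_⟩
  filter_upwards [ae_all_iff.2 fun i => ae_all_iff.2 fun j => hmeas (hcoef.memLp_a i j),
    ae_all_iff.2 fun j => hmeas (hcoef.memLp_b j), hmeas hcoef.memLp_c,
    hae (ae_all_iff.2 fun i => ae_all_iff.2 fun j => hAa i j), hae (ae_all_iff.2 hAb), hae hAc,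
    hae hell] with t h1 h2 h3 h4 h5 h6 h7
  have p1 : 0 ≤ ∑ i, ∑ j, |Aa i j| := by positivity
  have p2 : 0 ≤ ∑ j, |Ab j| := by positivity
  refine ⟨h1, h2, h3, ?_, ?_, ?_, h7⟩
  · filter_upwards [h4] with x hx i j
    have q1 := Finset.single_le_sum (f := fun i => ∑ j, |Aa i j|) (fun i _ => by positivity)
      (Finset.mem_univ i)
    have q2 := Finset.single_le_sum (f := fun j => |Aa i j|) (fun i _ => by positivity)
      (Finset.mem_univ j)
    have := (hx i j).trans (le_abs_self _)
    rw [Real.norm_eq_abs] at this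
    linarith [abs_nonneg Ac]
  · filter_upwards [h5] with x hx j
    have q2 := Finset.single_le_sum (f := fun j => |Ab j|) (fun i _ => by positivity)
      (Finset.mem_univ j)
    have := (hx j).trans (le_abs_self _)
    rw [Real.norm_eq_abs] at this
    linarith [abs_nonneg Ac]
  · filter_upwards [h6] with x hx
    have := hx.trans (le_abs_self _)
    rw [Real.norm_eq_abs] at this
    linarith

namespace IsRegularTime
variable {A θ t : ℝ}

theorem integrable_formDensity (ht : IsRegularTime Ω a b c A θ t) (u v : H10 Ω) :
    Integrable (fun x => formDensity (fun i j => a i j (t, x)) (fun j => b j (t, x)) (c (t, x))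
      (grad Ω u x) (toL2 Ω u x) (grad Ω v x) (toL2 Ω v x)) (volume.restrict Ω) := by
  refine Integrable.mono' (((memLp_jetNorm u).integrable_mul (memLp_jetNorm v)).const_mul
    ((d * d + d + 1) * A)) ?_ ?_
  · have hg : ∀ (w : H10 Ω) (i : Fin d),
        AEStronglyMeasurable (fun x => grad Ω w x i) (volume.restrict Ω) := fun w i =>
      (EuclideanSpace.proj (𝕜 := ℝ) i).continuous.comp_aestronglyMeasurable
        (Lp.aestronglyMeasurable (grad Ω w))
    have hl : ∀ w : H10 Ω, AEStronglyMeasurable (fun x => toL2 Ω w x) (volume.restrict Ω) :=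
      fun w => Lp.aestronglyMeasurable (toL2 Ω w)
    refine ((Finset.aestronglyMeasurable_fun_sum _ fun i _ =>
      Finset.aestronglyMeasurable_fun_sum _ fun j _ => ?_).add
      (Finset.aestronglyMeasurable_fun_sum _ fun j _ => ?_)).add ?_
    · exact ((ht.meas_a i j).mul (hg u j)).mul (hg v i)
    · exact ((ht.meas_b j).mul (hg u j)).mul (hl v)
    · exact (ht.meas_c.mul (hl u)).mul (hl v)
  · filter_upwards [ht.bound_a, ht.bound_b, ht.bound_c] with x h1 h2 h3
    exact abs_formDensity_le h1 h2 h3 _ _ _ _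

theorem abs_form_le (ht : IsRegularTime Ω a b c A θ t) (hA : 0 ≤ A) (u v : H10 Ω) :
    |form Ω a b c u v t| ≤ 2 * ((d * d + d + 1) * A) * ‖u‖ * ‖v‖ := by
  rw [form_eq_integral_formDensity, ← Real.norm_eq_abs]
  refine (norm_integral_le_of_norm_le (((memLp_jetNorm u).integrable_mul
    (memLp_jetNorm v)).const_mul ((d * d + d + 1) * A)) ?_).trans ?_
  · filter_upwards [ht.bound_a, ht.bound_b, ht.bound_c] with x h1 h2 h3
    exact abs_formDensity_le h1 h2 h3 _ _ _ _
  · rw [integral_const_mul]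
    refine (mul_le_mul_of_nonneg_left (integral_jetNorm_mul_le u v) (by positivity)).trans
      (le_of_eq ?_)
    ring

theorem le_form_self (ht : IsRegularTime Ω a b c A θ t) (hθ : 0 < θ) (u : H10 Ω) :
    θ / 2 * ‖u‖ ^ 2 - ((d * A) ^ 2 / (2 * θ) + A + θ / 2) * ‖toL2 Ω u‖ ^ 2
      ≤ form Ω a b c u u t := by
  have h1 := integrable_norm_sq (toL2 Ω u)
  have h2 := integrable_norm_sq (grad Ω u)
  have h : ∫ x in Ω, (θ / 2 * ‖grad Ω u x‖ ^ 2 - ((d * A) ^ 2 / (2 * θ) + A) * ‖toL2 Ω u x‖ ^ 2)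
      ≤ form Ω a b c u u t := by
    rw [form_eq_integral_formDensity]
    refine integral_mono_ae ((h2.const_mul _).sub (h1.const_mul _))
      (ht.integrable_formDensity u u) ?_
    filter_upwards [ht.bound_b, ht.bound_c, ht.elliptic] with x h4 h5 h6
    rw [Real.norm_eq_abs, sq_abs]
    exact le_formDensity_self hθ h4 h5 (h6 _) _
  rw [integral_sub (h2.const_mul _) (h1.const_mul _), integral_const_mul, integral_const_mul,
    ← norm_sq_Lp_two, ← norm_sq_Lp_two] at h
  rw [norm_sq_H10 u]
  linarith

theorem form_add_right (ht : IsRegularTime Ω a b c A θ t) (u v w : H10 Ω) :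
    form Ω a b c u (v + w) t = form Ω a b c u v t + form Ω a b c u w t := by
  simp only [form_eq_integral_formDensity]
  rw [← integral_add (ht.integrable_formDensity u v) (ht.integrable_formDensity u w)]
  refine integral_congr_ae ?_
  rw [map_add, map_add]
  filter_upwards [Lp.coeFn_add (grad Ω v) (grad Ω w), Lp.coeFn_add (toL2 Ω v) (toL2 Ω w)]
    with x h1 h2
  rw [h1, h2]
  simp only [formDensity, Pi.add_apply, PiLp.add_apply, mul_add, Finset.sum_add_distrib]
  ring

end IsRegularTime
end

/-! ### Coercivity of the Riemann--Liouville derivative -/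

/-- The bound `B` makes `∫ exp (-2gs) x D^α x` meaningful, but `g` does not depend on it, nor on
`T`. -/
theorem exists_weight_rlDeriv_coercive {α : ℝ} (hα0 : 0 < α) (hα1 : α < 1) {K : ℝ}
    (hK : 0 < K) : ∃ g : ℝ, 0 < g ∧ ∀ (T : ℝ) (x : ℝ → ℝ) (B : ℝ), 0 < T →
      ContinuousOn x (Icc 0 T) → HasRLDeriv α T x →
      (∀ᵐ s ∂(volume.restrict (Ioo 0 T)), |rlDeriv α x s| ≤ B) →
      K * ∫ s in Ioo 0 T, Real.exp (-(2 * g) * s) * x s ^ 2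
        ≤ ∫ s in Ioo 0 T, Real.exp (-(2 * g) * s) * (x s * rlDeriv α x s) := by
  have hG : 0 < Real.Gamma α := Real.Gamma_pos_of_pos hα0
  obtain ⟨g, hg, H⟩ := exists_weight_abelIntegral_coercive hα0 hα1 (div_pos hK hG)
  refine ⟨g, hg, fun T x B hT hx hac hB => ?_⟩
  have hm : Measurable (rlDeriv α x) := measurable_deriv _
  -- Change the derivative on a null set, and outside `(0, T)`, to have it bounded everywhere.
  set h : ℝ → ℝ := {s | |rlDeriv α x s| ≤ B}.indicator (rlDeriv α x) with hh
  have hhm : Measurable h := hm.indicator (measurableSet_le hm.abs measurable_const)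
  have hhB : ∀ s, |h s| ≤ |B| := fun s => by
    by_cases hs : |rlDeriv α x s| ≤ B
    · rw [hh, indicator_of_mem (show s ∈ {s | |rlDeriv α x s| ≤ B} from hs)]
      exact hs.trans (le_abs_self B)
    · rw [hh, indicator_of_notMem (show s ∉ {s | |rlDeriv α x s| ≤ B} from hs), abs_zero]
      exact abs_nonneg B
  have heq : ∀ᵐ s, s ∈ Ioo 0 T → h s = rlDeriv α x s := by
    rw [ae_restrict_iff' measurableSet_Ioo] at hB
    filter_upwards [hB] with s hs hs'
    exact indicator_of_mem (show s ∈ {s | |rlDeriv α x s| ≤ B} from hs hs') _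
  have habel : ∀ t ∈ Ioo 0 T, abelIntegral α h t = abelIntegral α (rlDeriv α x) t := by
    intro t ht
    refine intervalIntegral.integral_congr_ae ?_
    filter_upwards [heq] with s hs hs'
    rw [uIoc_of_le ht.1.le] at hs'
    rw [hs ⟨hs'.1, hs'.2.trans_lt ht.2⟩]
  have key := H T h |B| hT.le hhm hhB
  have hae : ∀ᵐ s ∂(volume.restrict (Ioo 0 T)),
      h s = rlDeriv α x s ∧ abelIntegral α h s = Real.Gamma α * x s := by
    rw [ae_restrict_iff' measurableSet_Ioo]
    filter_upwards [heq, ae_eq_abelIntegral_rlDeriv hα0 hα1 hT hx hac] with s h1 h2 h3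
    exact ⟨h1 h3, (habel s h3).trans (h2 h3).symm⟩
  rw [← restrict_Ioo_eq_restrict_Ioc] at key
  have e1 : ∫ s in Ioo 0 T, Real.exp (-(2 * g) * s) * abelIntegral α h s ^ 2
      = Real.Gamma α ^ 2 * ∫ s in Ioo 0 T, Real.exp (-(2 * g) * s) * x s ^ 2 := by
    rw [← integral_const_mul]
    refine integral_congr_ae ?_
    filter_upwards [hae] with s hs
    rw [hs.2]; ring
  have e2 : ∫ s in Ioo 0 T, Real.exp (-(2 * g) * s) * (abelIntegral α h s * h s)
      = Real.Gamma α * ∫ s in Ioo 0 T, Real.exp (-(2 * g) * s) * (x s * rlDeriv α x s) := by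
    rw [← integral_const_mul]
    refine integral_congr_ae ?_
    filter_upwards [hae] with s hs
    rw [hs.2, hs.1]; ring
  rw [e1, e2] at key
  refine le_of_mul_le_mul_left (le_trans (le_of_eq ?_) key) hG
  field_simp

section
variable {d : ℕ} {Ω : Set (Euc d)} {e : ℕ → H10 Ω} {lam : ℕ → ℝ}

namespace IsDirichletEigenbasis

theorem inner_toL2 (he : IsDirichletEigenbasis Ω e lam) (i j : ℕ) :
    inner ℝ (toL2 Ω (e i)) (toL2 Ω (e j)) = if i = j then 1 else 0 :=
  orthonormal_iff_ite.1 he.orthonormal i j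

/-- The eigenvalue relation in weak form, for all test functions in `H¹₀(Ω)`, by density. -/
theorem inner_eq (he : IsDirichletEigenbasis Ω e lam) (j : ℕ) (v : H10 Ω) :
    inner ℝ (e j) v = (1 + lam j) * inner ℝ (toL2 Ω (e j)) (toL2 Ω v) := by
  set L : H10 Ω →L[ℝ] ℝ :=
    innerSL ℝ (e j) - (1 + lam j) • (innerSL ℝ (toL2 Ω (e j))).comp (toL2 Ω) with hL
  have hker : (⊤ : Submodule ℝ (H10 Ω)) ≤ LinearMap.ker L.toLinearMap := by
    rw [← he.dense_H10]
    refine Submodule.topologicalClosure_minimal _ (Submodule.span_le.2 ?_) L.isClosed_ker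
    rintro _ ⟨i, rfl⟩
    change inner ℝ (e j) (e i) - (1 + lam j) * inner ℝ (toL2 Ω (e j)) (toL2 Ω (e i)) = 0
    rw [inner_H10, he.inner_toL2, he.inner_grad]
    split_ifs <;> ring
  have : L v = 0 := hker (Submodule.mem_top (x := v))
  exact sub_eq_zero.1 this

end IsDirichletEigenbasis

/-- The `L²`-orthogonal projection of `v` onto the Galerkin space. -/
noncomputable def galerkinProj {d : ℕ} {Ω : Set (Euc d)} (e : ℕ → H10 Ω) (N : ℕ) (v : H10 Ω) : H10 Ω :=
  ∑ i : Fin N, inner ℝ (toL2 Ω (e i)) (toL2 Ω v) • e i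

theorem galerkinProj_mem (e : ℕ → H10 Ω) (N : ℕ) (v : H10 Ω) :
    galerkinProj e N v ∈ galerkinSpace e N :=
  Submodule.sum_mem _ fun i _ => Submodule.smul_mem _ _ (Submodule.subset_span ⟨i, rfl⟩)

namespace IsDirichletEigenbasis

theorem inner_toL2_galerkinProj (he : IsDirichletEigenbasis Ω e lam) {N : ℕ} (j : Fin N)
    (v : H10 Ω) :
    inner ℝ (toL2 Ω (e j)) (toL2 Ω (galerkinProj e N v)) = inner ℝ (toL2 Ω (e j)) (toL2 Ω v) := by
  simp only [galerkinProj, map_sum, map_smul, inner_sum, inner_smul_right, he.inner_toL2,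
    Fin.val_inj, mul_ite, mul_one, mul_zero, Finset.sum_ite_eq, Finset.mem_univ, if_true]

/-- `v - P v` is `L²`-orthogonal to each `e j`, hence `H¹₀`-orthogonal to it by `inner_eq`. -/
theorem norm_galerkinProj_le (he : IsDirichletEigenbasis Ω e lam) (N : ℕ) (v : H10 Ω) :
    ‖galerkinProj e N v‖ ≤ ‖v‖ := by
  set P := galerkinProj e N v with hP
  have h0 : inner ℝ P (v - P) = 0 := by
    have : ∀ j : Fin N, inner ℝ (e j) (v - P) = 0 := fun j => by
      rw [he.inner_eq, map_sub, inner_sub_right, hP, he.inner_toL2_galerkinProj, sub_self,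
        mul_zero]
    have hsum : ∀ w : H10 Ω, inner ℝ P w
        = ∑ j : Fin N, inner ℝ (toL2 Ω (e j)) (toL2 Ω v) * inner ℝ (e j) w := fun w => by
      rw [hP, galerkinProj, sum_inner]
      exact Finset.sum_congr rfl fun j _ => real_inner_smul_left (F := H10 Ω) _ _ _
    rw [hsum]
    exact Finset.sum_eq_zero fun j _ => by rw [this, mul_zero]
  refine (sq_le_sq₀ (norm_nonneg _) (norm_nonneg _)).1 ?_
  have := norm_add_sq_real P (v - P)
  rw [h0, add_sub_cancel] at this
  nlinarith [sq_nonneg ‖v - P‖]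

theorem inner_toL2_sum (he : IsDirichletEigenbasis Ω e lam) {N : ℕ} (k l : Fin N → ℝ) :
    inner ℝ (toL2 Ω (∑ i, k i • e i)) (toL2 Ω (∑ i, l i • e i)) = ∑ i, k i * l i := by
  simp only [map_sum, map_smul]
  refine ((he.orthonormal.comp (fun i : Fin N => (i : ℕ)) Fin.val_injective).inner_sum k l
    Finset.univ).trans ?_
  simp

end IsDirichletEigenbasis

instance : CompleteSpace (H10 Ω) := by
  unfold H10
  infer_instance

theorem toHm1_sum_smul {N : ℕ} (k : Fin N → ℝ) (v : Fin N → H10 Ω) :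
    toHm1 Ω (∑ i, k i • v i) = ∑ i, k i • toHm1 Ω (v i) := by
  ext w
  simp [toHm1]

theorem rlIntegral_sum_smul {X : Type*} [NormedAddCommGroup X] [NormedSpace ℝ X] [CompleteSpace X]
    {β T : ℝ}
    (hβ : 0 < β) {N : ℕ} {κ : Fin N → ℝ → ℝ} (hκ : ∀ i, ContinuousOn (κ i) (Icc 0 T))
    (v : Fin N → X) {u : ℝ → X} (hu : ∀ t ∈ Icc 0 T, u t = ∑ i, κ i t • v i) {t : ℝ}
    (ht : t ∈ Icc 0 T) : rlIntegral β u t = ∑ i, rlIntegral β (κ i) t • v i := by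
  have hi : ∀ i, IntervalIntegrable (fun s => (t - s) ^ (β - 1) * κ i s) volume 0 t := fun i => by
    have h1 : IntervalIntegrable (fun s : ℝ => (t - s) ^ (β - 1)) volume 0 t := by
      have := (intervalIntegral.intervalIntegrable_rpow' (a := t) (b := 0) (r := β - 1)
        (by linarith)).comp_sub_left t
      simpa using this
    refine h1.mul_continuousOn ((hκ i).mono ?_)
    rw [uIcc_of_le ht.1]
    exact Icc_subset_Icc_right ht.2
  have h2 : ∫ s in (0 : ℝ)..t, (t - s) ^ (β - 1) • u s
      = ∫ s in (0 : ℝ)..t, ∑ i, ((t - s) ^ (β - 1) * κ i s) • v i := by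
    refine intervalIntegral.integral_congr fun s hs => ?_
    rw [uIcc_of_le ht.1] at hs
    rw [hu s ⟨hs.1, hs.2.trans ht.2⟩, Finset.smul_sum]
    simp only [smul_smul]
  have h3 : ∀ i, IntervalIntegrable (fun s => ((t - s) ^ (β - 1) * κ i s) • v i) volume 0 t :=
    fun i => ⟨(hi i).1.smul_const _, (hi i).2.smul_const _⟩
  rw [rlIntegral, h2, intervalIntegral.integral_finsetSum fun i _ => h3 i, Finset.smul_sum]
  refine Finset.sum_congr rfl fun i _ => ?_
  rw [intervalIntegral.integral_smul_const, smul_smul]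
  rfl

theorem ae_rlDeriv_sum_smul {X : Type*} [NormedAddCommGroup X] [NormedSpace ℝ X] [CompleteSpace X]
    {α T : ℝ}
    (hα1 : α < 1) {N : ℕ} {κ : Fin N → ℝ → ℝ} (hκ : ∀ i, ContinuousOn (κ i) (Icc 0 T))
    (hac : ∀ i, HasRLDeriv α T (κ i)) (v : Fin N → X) {u : ℝ → X}
    (hu : ∀ t ∈ Icc 0 T, u t = ∑ i, κ i t • v i) :
    ∀ᵐ t ∂(volume.restrict (Ioo 0 T)), rlDeriv α u t = ∑ i, rlDeriv α (κ i) t • v i := by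
  rw [ae_restrict_iff' measurableSet_Ioo]
  filter_upwards [ae_all_iff.2 fun i => (hac i).ae_differentiableAt] with t ht htm
  have h1 : HasDerivAt (fun s => ∑ i, rlIntegral (1 - α) (κ i) s • v i)
      (∑ i, rlDeriv α (κ i) t • v i) t := by
    refine HasDerivAt.fun_sum fun i _ => HasDerivAt.smul_const ?_ _
    refine (ht i ?_).hasDerivAt
    rw [uIcc_of_le (htm.1.trans htm.2).le]
    exact Ioo_subset_Icc_self htm
  refine (h1.congr_of_eventuallyEq ?_).deriv
  filter_upwards [isOpen_Ioo.mem_nhds htm] with s hs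
  exact rlIntegral_sum_smul (by linarith) hκ v hu (Ioo_subset_Icc_self hs)

variable {a : Fin d → Fin d → ℝ × Euc d → ℝ}
  {b : Fin d → ℝ × Euc d → ℝ} {c : ℝ × Euc d → ℝ}

theorem form_zero_right (u : H10 Ω) (t : ℝ) : form Ω a b c u 0 t = 0 := by
  have h := form_smul_right (a := a) (b := b) (c := c) t 0 u (0 : H10 Ω)
  have h0 : (0 : ℝ) • (0 : H10 Ω) = 0 := zero_smul ℝ (0 : H10 Ω)
  rwa [h0, zero_mul] at h

/-- One null set of times serves all test functions, as the Galerkin space is finite-dimensional. -/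
theorem IsGalerkinSolution.ae_equation {T α : ℝ} {f : ℝ → Hm1 Ω} {N : ℕ} {u : ℝ → H10 Ω}
    (hu : IsGalerkinSolution Ω T α a b c f e N u) {A θ : ℝ}
    (hreg : ∀ᵐ t ∂(volume.restrict (Ioo 0 T)), IsRegularTime Ω a b c A θ t) :
    ∀ᵐ t ∂(volume.restrict (Ioo 0 T)), ∀ v ∈ galerkinSpace e N,
      inner ℝ (toL2 Ω (rlDeriv α u t)) (toL2 Ω v) + form Ω a b c (u t) v t = f t v := by
  have h1 : ∀ᵐ t ∂(volume.restrict (Ioo 0 T)), ∀ i : Fin N,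
      inner ℝ (toL2 Ω (rlDeriv α u t)) (toL2 Ω (e i)) + form Ω a b c (u t) (e i) t
        = f t (e i) :=
    ae_all_iff.2 fun i => hu.equation _ (Submodule.subset_span ⟨i, rfl⟩)
  filter_upwards [h1, hreg] with t ht hr v hv
  induction hv using Submodule.span_induction with
  | mem x hx =>
    obtain ⟨i, rfl⟩ := hx
    exact ht i
  | zero =>
    rw [form_zero_right, map_zero, map_zero, inner_zero_right, add_zero]
  | add x y _ _ hx hy =>
    rw [map_add, map_add, inner_add_right, hr.form_add_right]
    linear_combination hx + hy
  | smul r x _ hx =>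
    rw [map_smul, map_smul, inner_smul_right, form_smul_right, smul_eq_mul]
    linear_combination r * hx

end

/-! ### The dual norm of the derivative and the energy estimate -/

section
variable {d : ℕ} {Ω : Set (Euc d)} {e : ℕ → H10 Ω} {lam : ℕ → ℝ}
  {a : Fin d → Fin d → ℝ × Euc d → ℝ} {b : Fin d → ℝ × Euc d → ℝ} {c : ℝ × Euc d → ℝ}

/-- For `w` in the Galerkin space, testing with the Galerkin space suffices to bound the norm of `w`
in `H⁻¹(Ω)`. -/
theorem norm_toHm1_le_of_galerkin_equation (he : IsDirichletEigenbasis Ω e lam) {N : ℕ}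
    {w : H10 Ω} (hw : w ∈ galerkinSpace e N) {R : ℝ} (hR : 0 ≤ R)
    (h : ∀ v ∈ galerkinSpace e N, |inner ℝ (toL2 Ω w) (toL2 Ω v)| ≤ R * ‖v‖) :
    ‖toHm1 Ω w‖ ≤ R := by
  refine ContinuousLinearMap.opNorm_le_bound _ hR fun v => ?_
  have hP : inner ℝ (toL2 Ω w) (toL2 Ω v)
      = inner ℝ (toL2 Ω w) (toL2 Ω (galerkinProj e N v)) := by
    set L : H10 Ω →L[ℝ] ℝ :=
      (innerSL ℝ (toL2 Ω v - toL2 Ω (galerkinProj e N v))).comp (toL2 Ω) with hL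
    have hker : galerkinSpace e N ≤ LinearMap.ker L.toLinearMap := by
      refine Submodule.span_le.2 ?_
      rintro _ ⟨j, rfl⟩
      change inner ℝ (toL2 Ω v - toL2 Ω (galerkinProj e N v)) (toL2 Ω (e j)) = 0
      rw [real_inner_comm, inner_sub_right, he.inner_toL2_galerkinProj, sub_self]
    have h0 : inner ℝ (toL2 Ω v - toL2 Ω (galerkinProj e N v)) (toL2 Ω w) = 0 := hker hw
    rw [real_inner_comm, inner_sub_right] at h0
    exact sub_eq_zero.1 h0
  change |inner ℝ (toL2 Ω w) (toL2 Ω v)| ≤ R * ‖v‖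
  rw [hP]
  exact (h _ (galerkinProj_mem e N v)).trans
    (mul_le_mul_of_nonneg_left (he.norm_galerkinProj_le N v) hR)

theorem sq_eLpNorm_two_le {X F : Type*} [MeasurableSpace X] [NormedAddCommGroup F]
    {μ : Measure X} {w : X → F} (hw : MemLp w 2 μ) {R : ℝ} (hR : ∫ x, ‖w x‖ ^ 2 ∂μ ≤ R) :
    eLpNorm w 2 μ ^ 2 ≤ ENNReal.ofReal R := by
  have h := hw.eLpNorm_eq_integral_rpow_norm two_ne_zero ENNReal.ofNat_ne_top
  simp only [ENNReal.toReal_ofNat, Real.rpow_two] at h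
  have h0 : 0 ≤ ∫ x, ‖w x‖ ^ 2 ∂μ := integral_nonneg fun x => sq_nonneg _
  rw [h, ← ENNReal.ofReal_pow (by positivity)]
  refine ENNReal.ofReal_le_ofReal (le_trans (le_of_eq ?_) hR)
  rw [← Real.rpow_natCast, ← Real.rpow_mul h0]
  norm_num

theorem memLp_two_of_continuousOn_Icc {X : Type*} [NormedAddCommGroup X] {T : ℝ} {w : ℝ → X}
    (hw : ContinuousOn w (Icc 0 T)) : MemLp w 2 (volume.restrict (Ioo 0 T)) := by
  obtain ⟨B, hB⟩ := isCompact_Icc.exists_bound_of_continuousOn hw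
  refine MemLp.of_bound ((hw.mono Ioo_subset_Icc_self).aestronglyMeasurable measurableSet_Ioo)
    B ?_
  filter_upwards [ae_restrict_mem measurableSet_Ioo] with t ht
  exact hB t (Ioo_subset_Icc_self ht)

theorem memLp_two_and_sq_eLpNorm_le_of_sum_smul {X : Type*} [NormedAddCommGroup X]
    [NormedSpace ℝ X] {T F M R : ℝ} (hT : 0 ≤ T) {N : ℕ} {h : Fin N → ℝ → ℝ}
    (hh : ∀ i, Measurable (h i)) (v : Fin N → X) {w : ℝ → X}
    (hw : ∀ᵐ t ∂(volume.restrict (Ioo 0 T)), w t = ∑ i, h i t • v i) {n : ℝ → ℝ}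
    (hn : ContinuousOn n (Icc 0 T))
    (hb : ∀ᵐ t ∂(volume.restrict (Ioo 0 T)), ‖w t‖ ≤ F + M * n t)
    (hR : ∫ t in Ioo 0 T, n t ^ 2 ≤ R) :
    MemLp w 2 (volume.restrict (Ioo 0 T)) ∧
      eLpNorm w 2 (volume.restrict (Ioo 0 T)) ^ 2
        ≤ ENNReal.ofReal (2 * T * F ^ 2 + 2 * M ^ 2 * R) := by
  have hwm : AEStronglyMeasurable w (volume.restrict (Ioo 0 T)) := by
    refine AEStronglyMeasurable.congr (f := fun t => ∑ i, h i t • v i) ?_ ?_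
    · exact Finset.aestronglyMeasurable_fun_sum _ fun i _ =>
        (hh i).aestronglyMeasurable.smul_const _
    · filter_upwards [hw] with t ht using ht.symm
  have hb2 : MemLp (fun t => F + M * n t) 2 (volume.restrict (Ioo 0 T)) :=
    memLp_two_of_continuousOn_Icc (continuousOn_const.add (continuousOn_const.mul hn))
  have hn2 : Integrable (fun t => n t ^ 2) (volume.restrict (Ioo 0 T)) :=
    (memLp_two_of_continuousOn_Icc hn).integrable_sq
  have hw2 : MemLp w 2 (volume.restrict (Ioo 0 T)) :=
    hb2.of_le hwm (hb.mono fun t ht => ht.trans (le_abs_self _))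
  refine ⟨hw2, sq_eLpNorm_two_le hw2 ?_⟩
  have q1 : ∫ t in Ioo 0 T, ‖w t‖ ^ 2 ≤ ∫ t in Ioo 0 T, (2 * F ^ 2 + 2 * M ^ 2 * n t ^ 2) := by
    refine integral_mono_ae (hw2.integrable_norm_pow (by norm_num))
      ((integrable_const _).add (hn2.const_mul _)) ?_
    filter_upwards [hb] with t ht
    have := pow_le_pow_left₀ (norm_nonneg _) ht 2
    nlinarith [sq_nonneg (F - M * n t)]
  have q2 : ∫ _ in Ioo 0 T, 2 * F ^ 2 = T * (2 * F ^ 2) := by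
    simp [hT]
  rw [integral_add (integrable_const _) (hn2.const_mul _), q2, integral_const_mul] at q1
  linarith [mul_le_mul_of_nonneg_left hR (by positivity : 0 ≤ 2 * M ^ 2)]

section
variable {V : Type*} [NormedAddCommGroup V] [NormedSpace ℝ V]

theorem ae_norm_le_toReal_eLpNorm_top_dual {μ : Measure ℝ} {f : ℝ → StrongDual ℝ V}
    (hf : MemLp f ∞ μ) : ∀ᵐ t ∂μ, ‖f t‖ ≤ (eLpNorm f ∞ μ).toReal :=
  ae_norm_le_toReal_eLpNorm_top hf

/-- The case of functions with values in a dual space. Stating it for an abstract space `V` lets the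
topologies of `StrongDual ℝ V` be compared before a concrete space such as `H10 Ω` is
substituted. -/
theorem memLp_two_and_sq_eLpNorm_le_of_sum_smul_dual {T F M R : ℝ} (hT : 0 ≤ T) {N : ℕ}
    {h : Fin N → ℝ → ℝ} (hh : ∀ i, Measurable (h i)) (v : Fin N → StrongDual ℝ V)
    {w : ℝ → StrongDual ℝ V}
    (hw : ∀ᵐ t ∂(volume.restrict (Ioo 0 T)), w t = ∑ i, h i t • v i) {n : ℝ → ℝ}
    (hn : ContinuousOn n (Icc 0 T))
    (hb : ∀ᵐ t ∂(volume.restrict (Ioo 0 T)), ‖w t‖ ≤ F + M * n t)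
    (hR : ∫ t in Ioo 0 T, n t ^ 2 ≤ R) :
    MemLp w 2 (volume.restrict (Ioo 0 T)) ∧
      eLpNorm w 2 (volume.restrict (Ioo 0 T)) ^ 2
        ≤ ENNReal.ofReal (2 * T * F ^ 2 + 2 * M ^ 2 * R) :=
  memLp_two_and_sq_eLpNorm_le_of_sum_smul hT hh v hw hn hb hR

end

/-- The weighted energy estimate, with `n t` in the role of `‖u(t)‖` and `h i` of the derivative of
the coefficient `κ i`. Coercivity with constant `K + 1` absorbs the term with `K`. -/
theorem integral_norm_sq_le_of_energy {T F m K g : ℝ} (hT : 0 < T) (hm : 0 < m)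
    (hg : 0 < g) {N : ℕ} {κ h : Fin N → ℝ → ℝ} (hκ : ∀ i, ContinuousOn (κ i) (Icc 0 T))
    (hh : ∀ i, IntegrableOn (h i) (Ioo 0 T))
    (hpos : ∀ i, (K + 1) * ∫ s in Ioo 0 T, Real.exp (-(2 * g) * s) * κ i s ^ 2
      ≤ ∫ s in Ioo 0 T, Real.exp (-(2 * g) * s) * (κ i s * h i s))
    {n : ℝ → ℝ} (hn : ContinuousOn n (Icc 0 T))
    (hen : ∀ᵐ t ∂(volume.restrict (Ioo 0 T)),
      (∑ i, κ i t * h i t) + (m * n t ^ 2 - K * ∑ i, κ i t * κ i t) ≤ F * n t) :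
    ∫ t in Ioo 0 T, n t ^ 2 ≤ F ^ 2 * T / (m ^ 2 * Real.exp (-(2 * g) * T)) := by
  set E : ℝ → ℝ := fun s => Real.exp (-(2 * g) * s) with hE
  have hEc : ContinuousOn E (Icc 0 T) := by fun_prop
  have int : ∀ {w : ℝ → ℝ}, ContinuousOn w (Icc 0 T) → IntegrableOn w (Ioo 0 T) := fun hw =>
    (hw.integrableOn_Icc).mono_set Ioo_subset_Icc_self
  have i1 : ∀ i, IntegrableOn (fun s => E s * κ i s ^ 2) (Ioo 0 T) := fun i =>
    int (hEc.mul ((hκ i).pow 2))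
  have i2 : ∀ i, IntegrableOn (fun s => E s * (κ i s * h i s)) (Ioo 0 T) := fun i => by
    have := (hh i).continuousOn_mul_of_subset (hEc.mul (hκ i)) isCompact_Icc
      measurableSet_Ioo Ioo_subset_Icc_self
    exact this.congr_fun (fun s _ => mul_assoc _ _ _) measurableSet_Ioo
  have i3 : IntegrableOn (fun s => E s * n s ^ 2) (Ioo 0 T) := int (hEc.mul (hn.pow 2))
  have i4 : IntegrableOn (fun s => n s ^ 2) (Ioo 0 T) := int (hn.pow 2)
  have hE1 : ∀ s ∈ Ioo 0 T, E s ≤ 1 := fun s hs => by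
    rw [hE, Real.exp_le_one_iff]; nlinarith [hs.1]
  have hE2 : ∀ s ∈ Ioo 0 T, Real.exp (-(2 * g) * T) ≤ E s := fun s hs => by
    rw [hE, Real.exp_le_exp]; nlinarith [hs.2]
  have mem : ∀ᵐ t ∂(volume.restrict (Ioo 0 T)), t ∈ Ioo 0 T := ae_restrict_mem measurableSet_Ioo
  have p1 : ∫ s in Ioo 0 T, ((∑ i, E s * (κ i s * h i s)) + m / 2 * (E s * n s ^ 2))
      ≤ ∫ s in Ioo 0 T, (K * (∑ i, E s * κ i s ^ 2) + F ^ 2 / (2 * m)) := by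
    refine integral_mono_ae
      ((integrable_finsetSum _ fun i _ => i2 i).add (i3.const_mul _))
      (((integrable_finsetSum _ fun i _ => i1 i).const_mul K).add (integrable_const _)) ?_
    filter_upwards [hen, mem] with t ht htm
    have q0 : F * n t ≤ m / 2 * n t ^ 2 + F ^ 2 / (2 * m) := by
      have h1 : 0 ≤ 1 / (2 * m) * (m * n t - F) ^ 2 := by positivity
      have h2 : 1 / (2 * m) * (m * n t - F) ^ 2
          = m / 2 * n t ^ 2 + F ^ 2 / (2 * m) - F * n t := by
        field_simp
        ring
      linarith
    have q1 : (∑ i, κ i t * h i t) + m / 2 * n t ^ 2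
        ≤ K * ∑ i, κ i t * κ i t + F ^ 2 / (2 * m) := by linarith
    have q2 := mul_le_mul_of_nonneg_left q1 (Real.exp_pos (-(2 * g) * t)).le
    have q3 : E t * (F ^ 2 / (2 * m)) ≤ F ^ 2 / (2 * m) :=
      mul_le_of_le_one_left (by positivity) (hE1 t htm)
    have e1 : ∑ i, E t * (κ i t * h i t) = E t * ∑ i, κ i t * h i t := by rw [Finset.mul_sum]
    have e2 : ∑ i, E t * κ i t ^ 2 = E t * ∑ i, κ i t * κ i t := by
      rw [Finset.mul_sum]; exact Finset.sum_congr rfl fun i _ => by ring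
    rw [e1, e2]
    have e3 : Real.exp (-(2 * g) * t) = E t := rfl
    rw [e3] at q2
    linarith
  rw [integral_add (integrable_finsetSum _ fun i _ => i2 i) (i3.const_mul _),
    integral_add ((integrable_finsetSum _ fun i _ => i1 i).const_mul K) (integrable_const _),
    integral_const_mul, integral_const_mul, integral_finsetSum _ fun i _ => i2 i,
    integral_finsetSum _ fun i _ => i1 i] at p1
  have p2 := Finset.sum_le_sum fun i (_ : i ∈ Finset.univ) => hpos i
  rw [← Finset.mul_sum] at p2
  have p3 : 0 ≤ ∑ i, ∫ s in Ioo 0 T, E s * κ i s ^ 2 :=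
    Finset.sum_nonneg fun i _ => integral_nonneg fun s =>
      mul_nonneg (Real.exp_pos _).le (sq_nonneg _)
  have p4 : ∫ _ in Ioo 0 T, F ^ 2 / (2 * m) = T * (F ^ 2 / (2 * m)) := by
    simp [hT.le]
  rw [p4] at p1
  have p5 : Real.exp (-(2 * g) * T) * ∫ s in Ioo 0 T, n s ^ 2
      ≤ ∫ s in Ioo 0 T, E s * n s ^ 2 := by
    rw [← integral_const_mul]
    refine setIntegral_mono_on (i4.const_mul _) i3 measurableSet_Ioo fun s hs => ?_
    exact mul_le_mul_of_nonneg_right (hE2 s hs) (sq_nonneg _)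
  have p6 : m / 2 * ∫ s in Ioo 0 T, E s * n s ^ 2 ≤ T * (F ^ 2 / (2 * m)) := by
    linarith
  have hE0 := Real.exp_pos (-(2 * g) * T)
  rw [le_div_iff₀ (by positivity)]
  have p7 := mul_le_mul_of_nonneg_left p6 (by positivity : 0 ≤ 2 * m)
  have e7 : 2 * m * (T * (F ^ 2 / (2 * m))) = F ^ 2 * T := by field_simp
  rw [e7] at p7
  nlinarith [mul_le_mul_of_nonneg_left p5 (sq_nonneg m)]

end

end FracElliptic

set_option maxHeartbeats 1000000 in
theorem proposition3p3 {d : ℕ} (hd : 0 < d) (Ω : Set (Euc d)) (hΩ : IsBoundedC1Domain Ω)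
    (T : ℝ) (hT : 0 < T) (α : ℝ) (hα0 : 0 < α) (hα1 : α < 1)
    (a : Fin d → Fin d → ℝ × Euc d → ℝ) (b : Fin d → ℝ × Euc d → ℝ) (c : ℝ × Euc d → ℝ)
    (hcoef : IsAdmissible Ω T a b c) :
    ∃ C : ℝ, 0 < C ∧
      ∀ (e : ℕ → H10 Ω) (lam : ℕ → ℝ), IsDirichletEigenbasis Ω e lam →
      ∀ f : ℝ → Hm1 Ω, MemLp f ∞ (volume.restrict (Icc 0 T)) →
      ∀ (N : ℕ) (u : ℝ → H10 Ω), IsGalerkinSolution Ω T α a b c f e N u →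
        MemLp (fun t => toL2 Ω (u t)) 2 (volume.restrict (Icc 0 T)) ∧
        MemLp u 2 (volume.restrict (Icc 0 T)) ∧
        MemLp (fun t => toHm1 Ω (rlDeriv α u t)) 2 (volume.restrict (Icc 0 T)) ∧
        eLpNorm (fun t => toL2 Ω (u t)) 2 (volume.restrict (Icc 0 T)) ^ 2
          + eLpNorm u 2 (volume.restrict (Icc 0 T)) ^ 2
          + eLpNorm (fun t => toHm1 Ω (rlDeriv α u t)) 2 (volume.restrict (Icc 0 T)) ^ 2
          ≤ ENNReal.ofReal C * eLpNorm f ∞ (volume.restrict (Icc 0 T)) ^ 2 := by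
  obtain ⟨A, θ, hA, hθ, hreg⟩ := hcoef.exists_ae_isRegularTime
  set M : ℝ := 2 * ((d * d + d + 1) * A) with hM
  have hM0 : 0 ≤ M := by positivity
  set K : ℝ := (d * A) ^ 2 / (2 * θ) + A + θ / 2 with hK
  have hK0 : 0 ≤ K := by positivity
  obtain ⟨g, hg, hcoer⟩ := exists_weight_rlDeriv_coercive hα0 hα1 (by positivity : 0 < K + 1)
  set S : ℝ := T / ((θ / 2) ^ 2 * Real.exp (-(2 * g) * T)) with hS
  have hS0 : 0 < S := div_pos hT (mul_pos (by positivity) (Real.exp_pos _))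
  refine ⟨S + S + (2 * T + 2 * M ^ 2 * S), by positivity, fun e lam he f hf N u hu => ?_⟩
  rw [← Measure.restrict_congr_set (Ioo_ae_eq_Icc (μ := volume) (a := (0 : ℝ)) (b := T))] at hf ⊢
  set μ : Measure ℝ := volume.restrict (Ioo 0 T) with hμ
  set F : ℝ := (eLpNorm f ∞ μ).toReal with hF
  have hF0 : 0 ≤ F := ENNReal.toReal_nonneg
  have hfF : ∀ᵐ t ∂μ, ‖f t‖ ≤ F := ae_norm_le_toReal_eLpNorm_top_dual hf
  obtain ⟨κ, hκc, hκd, hκu⟩ := hu.expansion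
  have huc : ContinuousOn u (Icc 0 T) := by
    refine ContinuousOn.congr (continuousOn_finsetSum _ fun i _ =>
      (hκc i).smul continuousOn_const) hκu
  obtain ⟨B, hB⟩ := isCompact_Icc.exists_bound_of_continuousOn huc
  have mem : ∀ᵐ t ∂μ, t ∈ Ioo 0 T := ae_restrict_mem measurableSet_Ioo
  have hD := ae_rlDeriv_sum_smul hα1 hκc hκd (fun i : Fin N => e i) hκu
  have heq := hu.ae_equation hreg
  have hspace : ∀ k : Fin N → ℝ, ∑ i, k i • e i ∈ galerkinSpace e N := fun k =>
    Submodule.sum_mem _ fun i _ => Submodule.smul_mem _ _ (Submodule.subset_span ⟨i, rfl⟩)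
  -- The equation bounds the functional `v ↦ (D^α u, v)` on the Galerkin space.
  have hfun : ∀ᵐ t ∂μ, ∀ v ∈ galerkinSpace e N,
      |inner ℝ (toL2 Ω (rlDeriv α u t)) (toL2 Ω v)| ≤ (F + M * ‖u t‖) * ‖v‖ := by
    filter_upwards [heq, hreg, hfF] with t h1 h2 h3 v hv
    have q1 := h1 v hv
    have q2 := h2.abs_form_le hA (u t) v
    have q3 : |f t v| ≤ F * ‖v‖ :=
      ((f t).le_opNorm v).trans (mul_le_mul_of_nonneg_right h3 (norm_nonneg v))
    have q4 : inner ℝ (toL2 Ω (rlDeriv α u t)) (toL2 Ω v) = f t v - form Ω a b c (u t) v t := by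
      linarith
    rw [q4]
    refine (abs_sub _ _).trans ?_
    rw [← hM] at q2
    linarith
  -- In particular the derivatives of the coefficients are bounded; the bound may depend on `N`.
  have hhb : ∀ i, ∀ᵐ t ∂μ, |rlDeriv α (κ i) t| ≤ (F + M * B) * ‖e i‖ := fun i => by
    filter_upwards [hfun, hD, mem] with t h1 h2 h3
    have q1 := h1 (e i) (Submodule.subset_span ⟨i, rfl⟩)
    have q2 : inner ℝ (toL2 Ω (rlDeriv α u t)) (toL2 Ω (e i)) = rlDeriv α (κ i) t := by
      rw [h2]
      simp [sum_inner, inner_smul_left, he.inner_toL2, Fin.val_inj]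
    rw [q2] at q1
    refine q1.trans (mul_le_mul_of_nonneg_right ?_ (norm_nonneg _))
    have := hB t (Ioo_subset_Icc_self h3)
    gcongr
  have hhm : ∀ i, Measurable (rlDeriv α (κ i)) := fun i => measurable_deriv _
  have hmain : ∫ t, ‖u t‖ ^ 2 ∂μ ≤ S * F ^ 2 := by
    have := integral_norm_sq_le_of_energy (F := F) hT (half_pos hθ) hg hκc
      (h := fun i => rlDeriv α (κ i))
      (fun i => (integrable_const _).mono' (hhm i).aestronglyMeasurable (hhb i))
      (fun i => hcoer T (κ i) _ hT (hκc i) (hκd i) (hhb i)) huc.norm ?_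
    · refine this.trans (le_of_eq ?_)
      rw [hS]; ring
    · filter_upwards [heq, hreg, hfF, hD, mem] with t h1 h2 h3 h4 h5
      have hut := hκu t (Ioo_subset_Icc_self h5)
      have q1 := h1 (u t) (hut ▸ hspace _)
      have q2 := h2.le_form_self hθ (u t)
      have q3 : f t (u t) ≤ F * ‖u t‖ := (le_abs_self _).trans
        (((f t).le_opNorm _).trans (mul_le_mul_of_nonneg_right h3 (norm_nonneg _)))
      have q4 : inner ℝ (toL2 Ω (rlDeriv α u t)) (toL2 Ω (u t))
          = ∑ i, κ i t * rlDeriv α (κ i) t := by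
        rw [h4, hut, he.inner_toL2_sum]
        exact Finset.sum_congr rfl fun i _ => mul_comm _ _
      have q5 : ‖toL2 Ω (u t)‖ ^ 2 = ∑ i, κ i t * κ i t := by
        rw [← real_inner_self_eq_norm_sq, hut, he.inner_toL2_sum]
      rw [q4] at q1
      rw [q5, ← hK] at q2
      linarith
  have hu2 : MemLp u 2 μ := memLp_two_of_continuousOn_Icc huc
  have hw2 : MemLp (fun t => toL2 Ω (u t)) 2 μ := (toL2 Ω).comp_memLp' hu2
  have hDb : ∀ᵐ t ∂μ, ‖toHm1 Ω (rlDeriv α u t)‖ ≤ F + M * ‖u t‖ := by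
    filter_upwards [hfun, hD] with t h1 h2
    exact norm_toHm1_le_of_galerkin_equation he (h2 ▸ hspace _) (by positivity) h1
  obtain ⟨hD2, b3⟩ := memLp_two_and_sq_eLpNorm_le_of_sum_smul_dual hT.le hhm
    (fun i : Fin N => toHm1 Ω (e i)) (w := fun t => toHm1 Ω (rlDeriv α u t))
    (by filter_upwards [hD] with t ht; rw [ht, toHm1_sum_smul]) huc.norm hDb hmain
  refine ⟨hw2, hu2, hD2, ?_⟩
  have b2 := sq_eLpNorm_two_le hu2 hmain
  have b1 : eLpNorm (fun t => toL2 Ω (u t)) 2 μ ^ 2 ≤ ENNReal.ofReal (S * F ^ 2) :=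
    (pow_le_pow_left₀ zero_le (eLpNorm_mono fun t => norm_toL2_le (u t)) 2).trans b2
  have hfF' : eLpNorm f ∞ μ = ENNReal.ofReal F := (ENNReal.ofReal_toReal hf.eLpNorm_ne_top).symm
  rw [hfF', ← ENNReal.ofReal_pow hF0, ← ENNReal.ofReal_mul (by positivity)]
  refine (add_le_add (add_le_add b1 b2) b3).trans (le_of_eq ?_)
  rw [← ENNReal.ofReal_add (by positivity) (by positivity),
    ← ENNReal.ofReal_add (by positivity) (by positivity)]
  congr 1
  ring
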